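/- **Setting.** Let $d=n+2$. Let $C\subset\mathbb P^2$ be a real rational curve of degree $d-2$ with normalization $\nu:\mathbb P^1\to C$ over $\mathbb R$, $\nu=(q_0:q_1:q_2)$ with real binary forms $q_i$ of degree $d-2$. Let $D^+=\{s=0\}$ and $D^-=\{m=0\}$ be disjoint real effective divisors on $\mathbb P^1$, of degrees $d$ and $2$, with real equations $s,m$. These data define the real curve $K'=(mq_0:mq_1:mq_2:s)$ of degree $d$ in $\mathbb P^3$, which projects to $C$ from $p=(0:0:0:1)$, passes through $p$ along $D^-$, and whose section by the plane $H=\{x_3=0\}$ is $D^+$. (The divisors determine $K'$ only up to $s\mapsto\lambda s$, $\lambda\in\mathbb R^*$. In small deformations the equations are deformed continuously, so that $K'$ is not replaced by its mirror image.) $(C,D)$, $D=D^+-D^-$, is a *nodal diagram* if all singularities of $C$ are simple nodes and the only singularity of $K'$ is a node at $p$ with two distinct tangents. It is *3D-explicit* if over each hyperbolic node of $C$ (a real node with two real branches) the two points of $K'$ are different from $p$, do not lie on $H$, and are separated by $H$ on the real affine line obtained by removing $p$ from the line joining them to $p$. Curves in $\mathbb P^3$ are *rigidly isotopic* if they are connected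 by a continuous family of embedded (over $\mathbb C$) real rational curves of degree $d$. *Resolving the double point $p$ of $K'$ in the direction $c=\pm1$* means deforming $K'$ continuously to a curve $K$, with all later members of the family embedded, so that right after the start the crossing near $p$ (two real branches, or two conjugate ones), seen in a generic real projection, has sign $c$. The sign is that of $\det(\gamma(a),\gamma'(a),\gamma(b),\gamma'(b))$ for the homogeneous parametrization $\gamma$ of the curve in a real affine coordinate of $\mathbb P^1$, $a,b$ being the two real or conjugate parameters of the crossing. Two resolutions are *coherent* if they have the same sign $c$. **Proposition.** Let $(C_1,D_1)$, $(C_2,D_2)$ be 3D-explicit nodal diagrams, with $C_j$ of degree $d-2$, related by one of the moves below. Then any curves $K_1,K_2\subset\mathbb P^3$ obtained from the corresponding curves $K_1',K_2'$ by resolving their double points in coherent directions are rigidly isotopic. In each move "close" and "small" mean: within a neighbourhood that depends only on the other data of the move (the curve $C$ or $C_0$, the divisors and the points that are given before the perturbation). In each move the central curve $K_0'$, defined by the pair indicated, is assumed to be nonsingular outside $p$. * **Moving a pole.** $C_1=C_2=C$ is nodal, $u$ is a hyperbolic node of $C$ with $\nu^{-1}(u)=\{u^+,u^-\}$, $D^+$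 and $D^-$ are real effective divisors of degrees $d-1$ and $1$, disjoint from each other and from the preimages of the nodes of $C$. $D_j^\pm=D^\pm+u_j^\pm$, where $u_1^+,u_2^+$ are real points close to $u^+$ on opposite sides of it, and $u_1^-,u_2^-$ are real points close to $u^-$ on opposite sides of it. Central pair: $C$, $(D^++u^+)-(D^-+u^-)$. * **Annihilation of two poles.** $C_1=C_2=C$ is nodal, $D_1^+=D_2^+=D^+$ is a real effective divisor of degree $d$ disjoint from the preimages of the nodes, $x$ is a real point of the normalization, not in $D^+$ and not over a node; $D_1^-$ consists of two distinct real points close to $x$ and $D_2^-$ of two conjugate non-real points close to $x$. Central pair: $C$, $D^+-2x$. * In the remaining moves $(C_j,D_j)$, $j=1,2$, are arbitrary small real deformations (of the parametrization and of the two divisors) of a pair $(C_0,D_0)$, where $C_0$ is a real rational curve of degree $d-2$ and $D_0=D_0^+-D_0^-$ with $D_0^\pm$ real, effective, disjoint from each other and from the preimages of the simple nodes of $C_0$, $\deg D_0^+=d$, $\deg D_0^-=2$. Central pair: $(C_0,D_0)$. * **Reidemeister 1.** $C_0$ has a single ordinary cusp and otherwise only simple nodes; $D_0^+$ contains the preimage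 of the cusp. * **Reidemeister 2.** $C_0$ has a single tacnode and otherwise only simple nodes; $D_0^\pm$ are disjoint from the two preimages of the tacnode. * **Reidemeister 3.** $C_0$ has a single ordinary triple point and otherwise only simple nodes; $D_0^+$ contains exactly one of its three preimages, and $D_0^-$ is not the sum of the two others. -/

import Mathlib

open Filter Topology
open scoped LinearAlgebra.Projectivization

noncomputable section

/-! ### Binary forms and real rational parametrized curves -/

/-- A real binary form of degree `n`, given by its coefficients: `f` stands for
`∑ i, f i * z₀ ^ i * z₁ ^ (n - i)`. A nonzero form, up to a scalar, is the same thing as a real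
(conjugation invariant) effective divisor of degree `n` on the projective line: its divisor of
zeros. -/
abbrev BinaryForm (n : ℕ) := Fin (n + 1) → ℝ

/-- The value of a binary form at a vector with entries in `ℝ` or in `ℂ`. A point of the
projective line is a nonzero vector, up to a scalar. -/
def formEval {A : Type*} [CommRing A] [Algebra ℝ A] {n : ℕ} (f : BinaryForm n) (z : Fin 2 → A) :
    A :=
  ∑ i : Fin (n + 1), f i • (z 0 ^ (i : ℕ) * z 1 ^ (n - (i : ℕ)))

/-- The product of two binary forms (the sum of the two divisors). -/
def formMul {k l : ℕ} (f : BinaryForm k) (g : BinaryForm l) : BinaryForm (k + l) :=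
  fun r => ∑ i : Fin (k + 1), ∑ j : Fin (l + 1),
    if (i : ℕ) + (j : ℕ) = (r : ℕ) then f i * g j else 0

/-- Two nonzero vectors `z`, `w` are the same point of the projective line if and only if
`cross z w = 0`; for real vectors the sign of `cross u w` tells in which direction `w` has been
moved from `u`. -/
def cross {A : Type*} [CommRing A] (z w : Fin 2 → A) : A := z 0 * w 1 - z 1 * w 0

/-- The linear form `z ↦ cross z u` that vanishes exactly at the point `u`. -/
def pointForm (u : Fin 2 → ℝ) : BinaryForm 1 := ![-u 0, u 1]

/-- A real vector, seen as a complex one. -/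
def toComplex (a : Fin 2 → ℝ) : Fin 2 → ℂ := fun i => (a i : ℂ)

/-- A (candidate for a) real rational curve of degree `n` in `ℙᵏ` with its parametrization by
`ℙ¹`: a `(k+1)`-tuple of real binary forms of degree `n`. -/
abbrev RatMap (k n : ℕ) := Fin (k + 1) → BinaryForm n

variable {k n : ℕ}

/-- The vector of homogeneous coordinates of the image of `z`. -/
def ratEval {A : Type*} [CommRing A] [Algebra ℝ A] (γ : RatMap k n) (z : Fin 2 → A) :
    Fin (k + 1) → A :=
  fun j => formEval (γ j) z

/-- The `r`-th derivative at `ε = 0` of `ε ↦ γ (z + ε v)`. If `cross z v ≠ 0`, then `ε` is a local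
coordinate of the projective line at `z`. -/
def jet (γ : RatMap k n) (z v : Fin 2 → ℂ) (r : ℕ) : Fin (k + 1) → ℂ :=
  iteratedDeriv r (fun ε : ℂ => ratEval γ (z + ε • v)) 0

/-- The partial derivative of the homogeneous parametrization with respect to `z i`. -/
def partialD (γ : RatMap k n) (z : Fin 2 → ℂ) (i : Fin 2) : Fin (k + 1) → ℂ :=
  jet γ z (Pi.single i 1) 1

/-- `γ` is an immersion at the point `z`: the two partial derivatives are independent. (By Euler's
relation their span contains the image of `z`, so this is the injectivity of the differential of
the map to projective space.) -/
def ImmersedAt (γ : RatMap k n) (z : Fin 2 → ℂ) : Prop :=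
  LinearIndependent ℂ ![partialD γ z 0, partialD γ z 1]

/-- The tangent line of the branch at `z`, as a vector subspace of `ℂᵏ⁺¹`. -/
def tangentLine (γ : RatMap k n) (z : Fin 2 → ℂ) : Submodule ℂ (Fin (k + 1) → ℂ) :=
  Submodule.span ℂ {partialD γ z 0, partialD γ z 1}

/-- `z` and `w` have the same image in `ℙᵏ` (for a `γ` without base points). -/
def SameImage (γ : RatMap k n) (z w : Fin 2 → ℂ) : Prop :=
  ¬ LinearIndependent ℂ ![ratEval γ z, ratEval γ w]

/-- There is no common zero of the coordinates on the complex projective line. -/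
def BasePointFree (γ : RatMap k n) : Prop :=
  ∀ z : Fin 2 → ℂ, z ≠ 0 → ratEval γ z ≠ 0

/-- `γ` embeds the complex projective line into `ℙᵏ`. -/
def Embedded (γ : RatMap k n) : Prop :=
  BasePointFree γ ∧ (∀ z w : Fin 2 → ℂ, cross z w ≠ 0 → ¬ SameImage γ z w) ∧
    ∀ z : Fin 2 → ℂ, z ≠ 0 → ImmersedAt γ z

/-- The complex curve parametrized by `γ`. -/
def curveOf (γ : RatMap k n) : Set (ℙ ℂ (Fin (k + 1) → ℂ)) :=
  {P | ∃ z : Fin 2 → ℂ, z ≠ 0 ∧ ∃ h : ratEval γ z ≠ 0, P = Projectivization.mk ℂ (ratEval γ z) h}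

/-- Rigid isotopy of real rational curves of degree `d` in `ℙ³`: a continuous deformation through
embedded (over `ℂ`) real rational curves of degree `d`. -/
def RigidlyIsotopic (d : ℕ) (K₁ K₂ : Set (ℙ ℂ (Fin 4 → ℂ))) : Prop :=
  ∃ Γ : ℝ → RatMap 3 d, ContinuousOn Γ (Set.Icc 0 1) ∧ (∀ t ∈ Set.Icc (0 : ℝ) 1, Embedded (Γ t)) ∧
    curveOf (Γ 0) = K₁ ∧ curveOf (Γ 1) = K₂

/-! ### Singular points of plane curves -/

/-- The branches at the two points `z`, `w` of the normalization form a simple node: they have the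
same image, which is not the image of any other point, both are smooth, and their tangents are
distinct. -/
def IsNode (q : RatMap 2 n) (z w : Fin 2 → ℂ) : Prop :=
  cross z w ≠ 0 ∧ SameImage q z w ∧
    (∀ x : Fin 2 → ℂ, x ≠ 0 → SameImage q z x → cross z x = 0 ∨ cross w x = 0) ∧
    ImmersedAt q z ∧ ImmersedAt q w ∧ tangentLine q z ≠ tangentLine q w

/-- `q` parametrizes a plane curve (birationally) and all singularities are simple nodes. -/
def IsNodalCurve (q : RatMap 2 n) : Prop :=
  BasePointFree q ∧ (∀ z : Fin 2 → ℂ, z ≠ 0 → ImmersedAt q z) ∧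
    ∀ z w : Fin 2 → ℂ, cross z w ≠ 0 → SameImage q z w → IsNode q z w

/-- The branch at `a` has an ordinary (semicubical) cusp. -/
def IsOrdinaryCusp (q : RatMap 2 n) (a : Fin 2 → ℂ) : Prop :=
  ∀ v : Fin 2 → ℂ, cross a v ≠ 0 →
    ¬ LinearIndependent ℂ ![jet q a v 0, jet q a v 1] ∧
      LinearIndependent ℂ ![jet q a v 0, jet q a v 2, jet q a v 3]

/-- The branches at `a`, `b` form a tacnode: they are smooth, tangent to each other, and their
intersection multiplicity is exactly two. (If `jet q b w 1 = σ • jet q a v 1 + ρ • jet q a v 0`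
and the two branches agree to the second order, then the Wronskian determinants at `b` and `a`
differ by the factor `σ ^ 3`, and conversely.) -/
def IsTacnode (q : RatMap 2 n) (a b : Fin 2 → ℂ) : Prop :=
  cross a b ≠ 0 ∧ SameImage q a b ∧ ImmersedAt q a ∧ ImmersedAt q b ∧
    ∀ v w : Fin 2 → ℂ, cross a v ≠ 0 → cross b w ≠ 0 →
      ∃ σ ρ : ℂ, jet q b w 1 = σ • jet q a v 1 + ρ • jet q a v 0 ∧
        Matrix.det (Matrix.of ![jet q b w 0, jet q b w 1, jet q b w 2]) ≠
          σ ^ 3 * Matrix.det (Matrix.of ![jet q a v 0, jet q a v 1, jet q a v 2])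

/-- The branches at the three points `a`, `b`, `c` form an ordinary triple point. -/
def IsTriplePoint (q : RatMap 2 n) (a b c : Fin 2 → ℂ) : Prop :=
  (cross a b ≠ 0 ∧ cross a c ≠ 0 ∧ cross b c ≠ 0) ∧
    (SameImage q a b ∧ SameImage q a c ∧ SameImage q b c) ∧
    (ImmersedAt q a ∧ ImmersedAt q b ∧ ImmersedAt q c) ∧
    tangentLine q a ≠ tangentLine q b ∧ tangentLine q a ≠ tangentLine q c ∧
      tangentLine q b ≠ tangentLine q c

/-- A single cusp, at the real point `a` of the normalization; otherwise simple nodes. -/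
def IsUnicuspidal (q : RatMap 2 n) (a : Fin 2 → ℝ) : Prop :=
  BasePointFree q ∧ a ≠ 0 ∧ IsOrdinaryCusp q (toComplex a) ∧
    (∀ z : Fin 2 → ℂ, z ≠ 0 → cross (toComplex a) z ≠ 0 → ImmersedAt q z) ∧
    ∀ z w : Fin 2 → ℂ, cross z w ≠ 0 → SameImage q z w → IsNode q z w

/-- A single tacnode, with branches at `a` and `b`; otherwise simple nodes. -/
def IsUnitacnodal (q : RatMap 2 n) (a b : Fin 2 → ℂ) : Prop :=
  BasePointFree q ∧ IsTacnode q a b ∧ (∀ z : Fin 2 → ℂ, z ≠ 0 → ImmersedAt q z) ∧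
    ∀ z w : Fin 2 → ℂ, cross z w ≠ 0 → SameImage q z w →
      IsNode q z w ∨ (cross z a = 0 ∧ cross w b = 0) ∨ (cross z b = 0 ∧ cross w a = 0)

/-- A single ordinary triple point, with branches at `a`, `b`, `c`; otherwise simple nodes. -/
def IsUnitriple (q : RatMap 2 n) (a b c : Fin 2 → ℂ) : Prop :=
  BasePointFree q ∧ IsTriplePoint q a b c ∧ (∀ z : Fin 2 → ℂ, z ≠ 0 → ImmersedAt q z) ∧
    ∀ z w : Fin 2 → ℂ, cross z w ≠ 0 → SameImage q z w →
      IsNode q z w ∨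
        ((cross z a = 0 ∨ cross z b = 0 ∨ cross z c = 0) ∧
          (cross w a = 0 ∨ cross w b = 0 ∨ cross w c = 0))

/-! ### Diagrams -/

/-- A plane curve `C` of degree `n = d - 2`, parametrized by `q`, with equations `s` and `m` of
the effective divisors `D⁺` (of degree `d = n + 2`) and `D⁻` (of degree two) on its
normalization. -/
abbrev Diagram (n : ℕ) := RatMap 2 n × BinaryForm (n + 2) × BinaryForm 2

/-- The curve `K' = (m q₀ : m q₁ : m q₂ : s)` of degree `d = n + 2` in `ℙ³` defined by a diagram:
its projection from `p = (0 : 0 : 0 : 1)` is `C`, it passes through `p` along `D⁻`, and `D⁺` is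
its section by the plane `x₃ = 0`. -/
def lift (X : Diagram n) : RatMap 3 (n + 2) :=
  ![formMul (X.1 0) X.2.2, formMul (X.1 1) X.2.2, formMul (X.1 2) X.2.2, X.2.1]

/-- The divisors `D⁺` and `D⁻` are disjoint. -/
def DisjointDivisors {k l : ℕ} (s : BinaryForm k) (m : BinaryForm l) : Prop :=
  ∀ z : Fin 2 → ℂ, z ≠ 0 → ¬ (formEval s z = 0 ∧ formEval m z = 0)

/-- A divisor is disjoint from the preimages of the simple nodes of `C`. -/
def AvoidsNodes {l : ℕ} (q : RatMap 2 n) (f : BinaryForm l) : Prop :=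
  ∀ z w : Fin 2 → ℂ, IsNode q z w → formEval f z ≠ 0

/-- `K' ∖ {p}` is nonsingular. -/
def SmoothOffVertex (X : Diagram n) : Prop :=
  ∀ z : Fin 2 → ℂ, z ≠ 0 → formEval X.2.2 z ≠ 0 →
    ImmersedAt (lift X) z ∧ ∀ w : Fin 2 → ℂ, cross z w ≠ 0 → ¬ SameImage (lift X) z w

/-- A nodal diagram: `C` is nodal, `D⁺` and `D⁻` are disjoint, and the only singularity of `K'` is
a node at `p`, that is, `D⁻` consists of two distinct points, and these have distinct images in
`ℙ²` (the directions of the two tangents of `K'` at `p`). -/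
def IsNodalDiagram (X : Diagram n) : Prop :=
  IsNodalCurve X.1 ∧ DisjointDivisors X.2.1 X.2.2 ∧
    (∃ x y : Fin 2 → ℂ, cross x y ≠ 0 ∧ formEval X.2.2 x = 0 ∧ formEval X.2.2 y = 0 ∧
      ¬ SameImage X.1 x y) ∧
    SmoothOffVertex X

/-- The diagram is 3D-explicit: over each hyperbolic node of `C` (a real node with two real
branches, at `a` and `b`), neither of the two points of `K'` lies on the plane `x₃ = 0` or is `p`,
and they are separated by that plane on the real line that joins them to `p`, with `p` removed.
On this line the affine coordinate with the zero on the plane and the pole at `p` takes at the two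
points the values `s a / m a` and `s b / (μ * m b)`. -/
def Is3DExplicit (X : Diagram n) : Prop :=
  ∀ a b : Fin 2 → ℝ, IsNode X.1 (toComplex a) (toComplex b) →
    ∃ μ : ℝ, ratEval X.1 b = μ • ratEval X.1 a ∧
      (formEval X.2.1 a / formEval X.2.2 a) *
        (formEval X.2.1 b / (μ * formEval X.2.2 b)) < 0

/-! ### Resolving the double point of a space curve -/

/-- The determinant of the two tangent lines at `z` and `w`. For two real branches of a space curve
its sign is the sign of their crossing (the linking sign of the two tangent lines); it does not
depend on the parametrization. For conjugate points it is real, too, and extends that sign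
continuously. -/
def crossingDet {d : ℕ} (γ : RatMap 3 d) (z w : Fin 2 → ℂ) : ℂ :=
  Matrix.det (Matrix.of ![partialD γ z 0, partialD γ z 1, partialD γ w 0, partialD γ w 1])

/-- Two real points, or two conjugate points, of the projective line. -/
def IsRealPair (z w : Fin 2 → ℂ) : Prop :=
  (∀ i, (z i).im = 0 ∧ (w i).im = 0) ∨ ∀ i, w i = (starRingEnd ℂ) (z i)

/-- `K` is obtained from the curve `γ` with one node by resolving its double point in the
direction `c = ± 1`: `Γ` is a deformation of `γ = Γ 0` into a parametrization `Γ 1` of `K` whose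
members are embedded for `t > 0`, and in the projection of `Γ t` from a real point `o` in general
position the crossing `(α t, β t)` that the node of `γ` becomes has the sign `c` for all small
`t > 0`. -/
def IsResolution {d : ℕ} (γ : RatMap 3 d) (c : ℤˣ) (K : Set (ℙ ℂ (Fin 4 → ℂ))) : Prop :=
  ∃ Γ : ℝ → RatMap 3 d, ContinuousOn Γ (Set.Icc 0 1) ∧ Γ 0 = γ ∧
    (∀ t ∈ Set.Ioc (0 : ℝ) 1, Embedded (Γ t)) ∧ curveOf (Γ 1) = K ∧
    ∃ a b : Fin 2 → ℂ, cross a b ≠ 0 ∧ SameImage γ a b ∧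
      ∃ o : Fin 4 → ℝ, (fun i => (o i : ℂ)) ∉ tangentLine γ a ⊔ tangentLine γ b ∧
        ∃ α β : ℝ → Fin 2 → ℂ, Tendsto α (𝓝[>] 0) (𝓝 a) ∧ Tendsto β (𝓝[>] 0) (𝓝 b) ∧
          ∀ᶠ t in 𝓝[>] (0 : ℝ), IsRealPair (α t) (β t) ∧
            (fun i => (o i : ℂ)) ∈
              Submodule.span ℂ {ratEval (Γ t) (α t), ratEval (Γ t) (β t)} ∧
            0 < ((c : ℤ) : ℝ) * (crossingDet (Γ t) (α t) (β t)).re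

/-- All curves obtained from the two curves `K'₁`, `K'₂` by resolving their double points in
coherent directions are rigidly isotopic. -/
def CoherentResolutionsIsotopic (X₁ X₂ : Diagram n) : Prop :=
  ∀ (c : ℤˣ) (K₁ K₂ : Set (ℙ ℂ (Fin 4 → ℂ))),
    IsResolution (lift X₁) c K₁ → IsResolution (lift X₂) c K₂ → RigidlyIsotopic (n + 2) K₁ K₂

/-- The diagram on the curve `q` with `D⁺ = {s = 0} ∪ {u}` and `D⁻ = {m = 0} ∪ {v}`. -/
def addPoints (q : RatMap 2 n) (s : BinaryForm (n + 1)) (m : BinaryForm 1) (u v : Fin 2 → ℝ) :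
    Diagram n :=
  (q, formMul (k := n + 1) (l := 1) s (pointForm u), formMul (k := 1) (l := 1) m (pointForm v))

/-- The form of degree two with a double zero at `x`. -/
def doublePoint (x : Fin 2 → ℝ) : BinaryForm 2 :=
  formMul (k := 1) (l := 1) (pointForm x) (pointForm x)

/-- The conclusion for diagrams `X₁`, `X₂` related by a move. -/
def ExplicitNodalDiagramsEquivalent (X₁ X₂ : Diagram n) : Prop :=
  IsNodalDiagram X₁ → Is3DExplicit X₁ → IsNodalDiagram X₂ → Is3DExplicit X₂ →
    CoherentResolutionsIsotopic X₁ X₂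

/-- The same for any two small deformations `X₁`, `X₂` of `X₀`. -/
def SmallDeformationsEquivalent (X₀ : Diagram n) : Prop :=
  ∃ U ∈ 𝓝 X₀, ∀ X₁ ∈ U, ∀ X₂ ∈ U, ExplicitNodalDiagramsEquivalent X₁ X₂

end

noncomputable section

/-! ### Calculus of binary forms -/

/-! All five moves hold for one reason. In each, the central curve $K_0'$ is smooth outside $p$, no
two distinct zeros of $m$ have the same image in $C$, and $C$ is immersed at the zeros of $m$. So
the only singularity of $K_0'$ is a node at $p$, or a cusp if $m$ has a double zero, and it can be
perturbed to exactly two sides. The singularities that $C$ acquires elsewhere are invisible in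
space. `IsCentral` isolates these conditions; once they are checked, the moves need no separate
treatment.

The curves near $K_0'$ are described by the chart `deform`: $(mQ+sc+bte:s)$, where $c$ moves the
double point to $(c:1)$, $b$ resolves it, and $e,t$ are fixed. If $z,w$ is a double point (or a
point of non-immersion, when $z=w$), the three equations containing the last coordinate, contracted
with $Q(z)\times Q(w)$, give $b\cdot E(z,w)=0$ with $E$ the `sideFactor`
(`Degenerate.mul_sideFactor_eq_zero`). For suitable $e,t$ this $E$ is nonzero at the double point of
$K_0'$ and positive on its real representatives (`IsCentral.exists_chart`). By compactness this
persists at all double points of curves in a ball around $K_0'$ in the chart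
(`eventually_isAdapted`). Hence every curve of the ball with $b\ne0$ is embedded, and each half $\pm
b>0$ of the ball is convex.

It remains to bring any resolution of a nearby nodal $K'$ into the correct half. At a nodal diagram
the chart is a submersion (`map_deform_nhds`), so the resolution, shortly after its start, is a
curve of the chart. The determinant of its crossing is $b$ times a factor of positive real part
(`eventually_crossingDet_re`), so the sign $c$ of the resolution is the sign of $b$
(`IsResolution.exists_joinedIn`). Coherent resolutions thus enter the same half and are joined there
by a segment (`IsCentral.exists_mem_nhds`). -/

theorem formEval_add {N : ℕ} (f g : BinaryForm N) (z : Fin 2 → ℂ) :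
    formEval (f + g) z = formEval f z + formEval g z := by
  simp [formEval, add_mul, Finset.sum_add_distrib]

theorem formEval_smul {N : ℕ} (r : ℝ) (f : BinaryForm N) (z : Fin 2 → ℂ) :
    formEval (r • f) z = r * formEval f z := by
  simp [formEval, Finset.mul_sum, mul_assoc]

theorem formEval_zero {N : ℕ} (z : Fin 2 → ℂ) : formEval (0 : BinaryForm N) z = 0 := by
  simp [formEval]

theorem formEval_scale {N : ℕ} (f : BinaryForm N) (c : ℂ) (z : Fin 2 → ℂ) :
    formEval f (c • z) = c ^ N * formEval f z := by
  simp only [formEval, Finset.mul_sum, Pi.smul_apply, smul_eq_mul, Complex.real_smul]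
  refine Finset.sum_congr rfl fun i _ => ?_
  have h : c ^ N = c ^ (i : ℕ) * c ^ (N - (i : ℕ)) := by
    rw [← pow_add]; congr 1; omega
  rw [h, mul_pow, mul_pow]; ring

theorem formEval_formMul {k l : ℕ} (f : BinaryForm k) (g : BinaryForm l) (z : Fin 2 → ℂ) :
    formEval (formMul f g) z = formEval f z * formEval g z := by
  simp only [formEval, formMul]
  rw [Finset.sum_mul_sum]
  simp only [Complex.real_smul, Complex.ofReal_sum, Finset.sum_mul]
  rw [Finset.sum_comm]
  refine Finset.sum_congr rfl fun i _ => ?_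
  rw [Finset.sum_comm]
  refine Finset.sum_congr rfl fun j _ => ?_
  rw [Finset.sum_eq_single (⟨i + j, by omega⟩ : Fin (k + l + 1))]
  · have h : k + l - (i + j : ℕ) = (k - i) + (l - j) := by omega
    simp only [if_true, Complex.ofReal_mul, h, pow_add]; ring
  · intro r _ hr
    rw [if_neg (fun h => hr (Fin.ext h.symm))]; simp
  · simp

theorem formEval_toComplex {N : ℕ} (f : BinaryForm N) (z : Fin 2 → ℝ) :
    formEval f (toComplex z) = (formEval f z : ℝ) := by
  simp [formEval, toComplex]

theorem continuous_formEval {N : ℕ} :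
    Continuous fun p : BinaryForm N × (Fin 2 → ℂ) => formEval p.1 p.2 := by
  unfold formEval; fun_prop

theorem continuous_formMul {k l : ℕ} :
    Continuous fun p : BinaryForm k × BinaryForm l => formMul p.1 p.2 := by
  unfold formMul
  refine continuous_pi fun r => continuous_finsetSum _ fun i _ => continuous_finsetSum _ fun j _ => ?_
  split_ifs <;> fun_prop

/-- The derivative of a binary form at `z` in the direction `v`. -/
def formDeriv {N : ℕ} (f : BinaryForm N) (z v : Fin 2 → ℂ) : ℂ :=
  ∑ i : Fin (N + 1), (f i : ℂ) *
    ((i : ℕ) * z 0 ^ ((i : ℕ) - 1) * v 0 * z 1 ^ (N - (i : ℕ)) +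
      z 0 ^ (i : ℕ) * ((N - (i : ℕ) : ℕ) * z 1 ^ (N - (i : ℕ) - 1) * v 1))

theorem hasDerivAt_formEval {N : ℕ} (f : BinaryForm N) (z v : Fin 2 → ℂ) :
    HasDerivAt (fun ε : ℂ => formEval f (z + ε • v)) (formDeriv f z v) 0 := by
  unfold formEval formDeriv
  simp only [Complex.real_smul, Pi.add_apply, Pi.smul_apply, smul_eq_mul]
  refine HasDerivAt.fun_sum fun i _ => HasDerivAt.const_mul _ ?_
  have h (k : Fin 2) : HasDerivAt (fun ε : ℂ => z k + ε * v k) (v k) 0 := by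
    simpa using ((hasDerivAt_id (0 : ℂ)).mul_const (v k)).const_add (z k)
  have := ((h 0).fun_pow (i : ℕ)).fun_mul ((h 1).fun_pow (N - (i : ℕ)))
  simpa using this

theorem formDeriv_formMul {k l : ℕ} (f : BinaryForm k) (g : BinaryForm l) (z v : Fin 2 → ℂ) :
    formDeriv (formMul f g) z v = formDeriv f z v * formEval g z + formEval f z * formDeriv g z v := by
  have h := hasDerivAt_formEval (formMul f g) z v
  simp only [formEval_formMul] at h
  have h' := (hasDerivAt_formEval f z v).mul (hasDerivAt_formEval g z v)
  simpa using h.unique h'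

theorem formDeriv_eq {N : ℕ} (f : BinaryForm N) (z v : Fin 2 → ℂ) :
    formDeriv f z v =
      v 0 * formDeriv f z (Pi.single 0 1) + v 1 * formDeriv f z (Pi.single 1 1) := by
  simp only [formDeriv, Finset.mul_sum, ← Finset.sum_add_distrib]
  refine Finset.sum_congr rfl fun i _ => ?_
  simp; ring

theorem formDeriv_self {N : ℕ} (f : BinaryForm N) (z : Fin 2 → ℂ) :
    formDeriv f z z = N * formEval f z := by
  simp only [formDeriv, formEval, Finset.mul_sum, Complex.real_smul]
  refine Finset.sum_congr rfl fun i _ => ?_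
  have h (a : ℂ) (k : ℕ) : (k : ℂ) * a ^ (k - 1) * a = k * a ^ k := by
    rcases k with _ | k
    · simp
    · simp [pow_succ, mul_assoc]
  rw [h, h, Nat.cast_sub (by omega)]
  ring

theorem continuous_formDeriv {N : ℕ} :
    Continuous fun p : BinaryForm N × (Fin 2 → ℂ) × (Fin 2 → ℂ) => formDeriv p.1 p.2.1 p.2.2 := by
  unfold formDeriv; fun_prop

theorem partialD_apply {k N : ℕ} (γ : RatMap k N) (z : Fin 2 → ℂ) (i : Fin 2) (j : Fin (k + 1)) :
    partialD γ z i j = formDeriv (γ j) z (Pi.single i 1) := by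
  have h : HasDerivAt (fun ε : ℂ => ratEval γ (z + ε • (Pi.single i 1 : Fin 2 → ℂ)))
      (fun j => formDeriv (γ j) z (Pi.single i 1)) 0 :=
    hasDerivAt_pi.2 fun j => hasDerivAt_formEval (γ j) z _
  rw [partialD, jet, iteratedDeriv_one, h.deriv]

/-! ### The bracket of two binary forms -/

/-- The quotient of `z₀ⁱ z₁ᴺ⁻ⁱ w₀ʲ w₁ᴺ⁻ʲ - w₀ⁱ w₁ᴺ⁻ⁱ z₀ʲ z₁ᴺ⁻ʲ` by `cross z w`. -/
def bracketMonomial (N i j : ℕ) (z w : Fin 2 → ℂ) : ℂ :=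
  (z 0 * w 0) ^ j * (z 1 * w 1) ^ (N - i) *
      ∑ r ∈ Finset.range (i - j), (z 0 * w 1) ^ r * (z 1 * w 0) ^ (i - j - 1 - r) -
    (z 0 * w 0) ^ i * (z 1 * w 1) ^ (N - j) *
      ∑ r ∈ Finset.range (j - i), (z 0 * w 1) ^ r * (z 1 * w 0) ^ (j - i - 1 - r)

/-- The quotient of `f z * g w - f w * g z` by `cross z w`. -/
def bracket {N : ℕ} (f g : BinaryForm N) (z w : Fin 2 → ℂ) : ℂ :=
  ∑ i : Fin (N + 1), ∑ j : Fin (N + 1), (f i : ℂ) * g j * bracketMonomial N i j z w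

theorem cross_mul_bracketMonomial (N i j : ℕ) (hi : i ≤ N) (hj : j ≤ N) (z w : Fin 2 → ℂ) :
    cross z w * bracketMonomial N i j z w =
      z 0 ^ i * z 1 ^ (N - i) * (w 0 ^ j * w 1 ^ (N - j)) -
        w 0 ^ i * w 1 ^ (N - i) * (z 0 ^ j * z 1 ^ (N - j)) := by
  have key (k : ℕ) := geom_sum₂_mul (z 0 * w 1) (z 1 * w 0) k
  rcases le_total i j with h | h
  · obtain ⟨k, rfl⟩ := Nat.exists_eq_add_of_le h
    obtain ⟨l, rfl⟩ := Nat.exists_eq_add_of_le hj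
    have h1 : i - (i + k) = 0 := by omega
    have h2 : i + k - i = k := by omega
    have h3 : i + k + l - (i + k) = l := by omega
    have h4 : i + k + l - i = k + l := by omega
    have hk := key k
    simp only [bracketMonomial, h1, h2, h3, h4, cross, Finset.range_zero, Finset.sum_empty, mul_zero,
      zero_sub, pow_add, mul_pow] at hk ⊢
    linear_combination (-(z 0 ^ i * w 0 ^ i * z 1 ^ l * w 1 ^ l)) * hk
  · obtain ⟨k, rfl⟩ := Nat.exists_eq_add_of_le h
    obtain ⟨l, rfl⟩ := Nat.exists_eq_add_of_le hi
    have h1 : j - (j + k) = 0 := by omega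
    have h2 : j + k - j = k := by omega
    have h3 : j + k + l - (j + k) = l := by omega
    have h4 : j + k + l - j = k + l := by omega
    have hk := key k
    simp only [bracketMonomial, h1, h2, h3, h4, cross, Finset.range_zero, Finset.sum_empty, mul_zero,
      sub_zero, pow_add, mul_pow] at hk ⊢
    linear_combination (z 0 ^ j * w 0 ^ j * z 1 ^ l * w 1 ^ l) * hk

theorem cross_mul_bracket {N : ℕ} (f g : BinaryForm N) (z w : Fin 2 → ℂ) :
    cross z w * bracket f g z w =
      formEval f z * formEval g w - formEval f w * formEval g z := by
  simp only [bracket, formEval]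
  rw [Finset.sum_mul_sum, Finset.sum_mul_sum]
  simp only [Finset.mul_sum, ← Finset.sum_sub_distrib, Complex.real_smul]
  refine Finset.sum_congr rfl fun i _ => Finset.sum_congr rfl fun j _ => ?_
  have := cross_mul_bracketMonomial N i j (by omega) (by omega) z w
  linear_combination (f i * g j : ℂ) * this

theorem continuous_bracket {N : ℕ} :
    Continuous fun p : BinaryForm N × BinaryForm N × (Fin 2 → ℂ) × (Fin 2 → ℂ) =>
      bracket p.1 p.2.1 p.2.2.1 p.2.2.2 := by
  unfold bracket bracketMonomial; fun_prop

theorem continuous_cross : Continuous fun p : (Fin 2 → ℂ) × (Fin 2 → ℂ) => cross p.1 p.2 := by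
  unfold cross; fun_prop

/-- The off-diagonal pairs are dense. An identity between brackets therefore needs a proof only
after multiplication by `cross z w`, where brackets become differences of products of values. -/
theorem eq_of_eq_of_cross_ne_zero {F G : (Fin 2 → ℂ) × (Fin 2 → ℂ) → ℂ} (hF : Continuous F)
    (hG : Continuous G) (h : ∀ z w, cross z w ≠ 0 → F (z, w) = G (z, w)) (z w : Fin 2 → ℂ) :
    F (z, w) = G (z, w) := by
  have hd : Dense {p : (Fin 2 → ℂ) × (Fin 2 → ℂ) | cross p.1 p.2 ≠ 0} := by
    rintro ⟨z, w⟩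
    let u : ℂ → (Fin 2 → ℂ) × (Fin 2 → ℂ) :=
      fun ε => (z + ε • ![1, 0], w + ε • ![0, 1])
    have hu : Tendsto u (𝓝[≠] 0) (𝓝 (z, w)) := by
      have : Continuous u := by fun_prop
      have h0 := this.tendsto 0
      simp only [u, zero_smul, add_zero] at h0
      exact h0.mono_left nhdsWithin_le_nhds
    refine mem_closure_of_tendsto hu ?_
    -- Along the perturbation `u`, `cross` is a monic quadratic polynomial in `ε`, so it has
    -- finitely many zeros.
    let P : Polynomial ℂ := (Polynomial.X + Polynomial.C (z 0)) *
      (Polynomial.X + Polynomial.C (w 1)) - Polynomial.C (z 1 * w 0)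
    have hP : P ≠ 0 := by
      have hm : ((Polynomial.X + Polynomial.C (z 0)) * (Polynomial.X + Polynomial.C (w 1))).Monic :=
        (Polynomial.monic_X_add_C _).mul (Polynomial.monic_X_add_C _)
      intro h0
      have h1 : (Polynomial.X + Polynomial.C (z 0)) * (Polynomial.X + Polynomial.C (w 1)) =
        Polynomial.C (z 1 * w 0) := sub_eq_zero.1 h0
      have h2 := congrArg Polynomial.natDegree h1
      rw [(Polynomial.monic_X_add_C _).natDegree_mul (Polynomial.monic_X_add_C _),
        Polynomial.natDegree_X_add_C, Polynomial.natDegree_X_add_C, Polynomial.natDegree_C] at h2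
      omega
    have hfin : {ε | P.IsRoot ε}.Finite := Polynomial.finite_setOfPred_isRoot hP
    have hc := (hfin.subset (Set.sdiff_subset (t := {0}))).isClosed.isOpen_compl.mem_nhds
      (x := (0 : ℂ)) (by simp)
    filter_upwards [mem_nhdsWithin_of_mem_nhds hc, self_mem_nhdsWithin] with ε h1 h2 h3
    refine h1 ⟨?_, h2⟩
    simp only [u, cross] at h3
    simp [Polynomial.IsRoot, P] at h3 ⊢
    linear_combination h3
  exact congrFun (hF.ext_on hd hG fun p hp => h p.1 p.2 hp) (z, w)

/-- The bracket has degree `N - 1` in each point; the extra factor `α * β` on the left avoids the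
subtraction in the exponent. -/
theorem bracket_scale {N : ℕ} (f g : BinaryForm N) (α β : ℂ) (z w : Fin 2 → ℂ) :
    α * β * bracket f g (α • z) (β • w) = (α * β) ^ N * bracket f g z w := by
  refine eq_of_eq_of_cross_ne_zero (F := fun p => α * β * bracket f g (α • p.1) (β • p.2))
    (G := fun p => (α * β) ^ N * bracket f g p.1 p.2) ?_ ?_ (fun z w h => ?_) z w
  · have := continuous_bracket (N := N); fun_prop
  · have := continuous_bracket (N := N); fun_prop
  · have h1 := cross_mul_bracket f g (α • z) (β • w)
    have h2 := cross_mul_bracket f g z w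
    simp only [formEval_scale] at h1
    refine mul_left_cancel₀ h ?_
    have h3 : cross (α • z) (β • w) = α * β * cross z w := by simp [cross]; ring
    rw [h3] at h1
    rw [mul_pow]
    linear_combination h1 - α ^ N * β ^ N * h2

theorem bracket_swap {N : ℕ} (f g : BinaryForm N) (z w : Fin 2 → ℂ) :
    bracket f g w z = bracket f g z w := by
  refine eq_of_eq_of_cross_ne_zero (F := fun p => bracket f g p.2 p.1)
    (G := fun p => bracket f g p.1 p.2) ?_ ?_ (fun z w h => ?_) z w
  · have := continuous_bracket (N := N); fun_prop
  · have := continuous_bracket (N := N); fun_prop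
  · have h1 := cross_mul_bracket f g w z
    have h2 := cross_mul_bracket f g z w
    refine mul_left_cancel₀ h ?_
    simp only [cross] at h1 h2 ⊢
    linear_combination -h1 - h2

theorem bracket_anticomm {N : ℕ} (f g : BinaryForm N) (z w : Fin 2 → ℂ) :
    bracket g f z w = -bracket f g z w := by
  refine eq_of_eq_of_cross_ne_zero (F := fun p => bracket g f p.1 p.2)
    (G := fun p => -bracket f g p.1 p.2) ?_ ?_ (fun z w h => ?_) z w
  · have := continuous_bracket (N := N); fun_prop
  · have := continuous_bracket (N := N); fun_prop
  · have h1 := cross_mul_bracket f g z w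
    have h2 := cross_mul_bracket g f z w
    refine mul_left_cancel₀ h ?_
    linear_combination h1 + h2

theorem bracket_add_left {N : ℕ} (f g h : BinaryForm N) (z w : Fin 2 → ℂ) :
    bracket (f + g) h z w = bracket f h z w + bracket g h z w := by
  simp [bracket, add_mul, Finset.sum_add_distrib]

theorem bracket_smul_left {N : ℕ} (r : ℝ) (f g : BinaryForm N) (z w : Fin 2 → ℂ) :
    bracket (r • f) g z w = r * bracket f g z w := by
  simp [bracket, Finset.mul_sum, mul_assoc]

theorem bracket_self {N : ℕ} (f : BinaryForm N) (z w : Fin 2 → ℂ) : bracket f f z w = 0 := by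
  have := bracket_anticomm f f z w
  exact self_eq_neg.1 this

theorem bracket_star {N : ℕ} (f g : BinaryForm N) (z w : Fin 2 → ℂ) :
    bracket f g (fun i => (starRingEnd ℂ) (z i)) (fun i => (starRingEnd ℂ) (w i)) =
      (starRingEnd ℂ) (bracket f g z w) := by
  simp [bracket, bracketMonomial]

/-- For conjugate points, complex conjugation exchanges `z` and `w`, and the bracket is symmetric in
them. This lets real and solitary double points be treated alike. -/
theorem IsRealPair.bracket_im {N : ℕ} (f g : BinaryForm N) {z w : Fin 2 → ℂ}
    (h : IsRealPair z w) : (bracket f g z w).im = 0 := by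
  rw [← Complex.conj_eq_iff_im, ← bracket_star]
  rcases h with h | h
  · have h1 (i : Fin 2) : (starRingEnd ℂ) (z i) = z i := Complex.conj_eq_iff_im.2 (h i).1
    have h2 (i : Fin 2) : (starRingEnd ℂ) (w i) = w i := Complex.conj_eq_iff_im.2 (h i).2
    simp only [h1, h2]
  · have hw : w = fun i => (starRingEnd ℂ) (z i) := funext h
    subst hw
    simp only [Complex.conj_conj]
    exact bracket_swap f g _ _

theorem cross_mul_bracket_self {N : ℕ} (f g : BinaryForm N) (z v : Fin 2 → ℂ) :
    cross z v * bracket f g z z =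
      formEval f z * formDeriv g z v - formDeriv f z v * formEval g z := by
  have h1 : HasDerivAt (fun ε : ℂ => formEval f z * formEval g (z + ε • v) -
      formEval f (z + ε • v) * formEval g z)
      (formEval f z * formDeriv g z v - formDeriv f z v * formEval g z) 0 :=
    ((hasDerivAt_formEval g z v).const_mul _).sub ((hasDerivAt_formEval f z v).mul_const _)
  have h2 : HasDerivAt (fun ε : ℂ => formEval f z * formEval g (z + ε • v) -
      formEval f (z + ε • v) * formEval g z) (cross z v * bracket f g z z) 0 := by
    -- The difference quotient at `ε` is `cross z v` times the bracket at `(z, z + ε • v)`, which is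
    -- continuous up to the diagonal.
    rw [hasDerivAt_iff_tendsto_slope]
    have h3 : Tendsto (fun ε : ℂ => cross z v * bracket f g z (z + ε • v)) (𝓝[≠] 0)
        (𝓝 (cross z v * bracket f g z z)) := by
      have hb : Continuous fun ε : ℂ => cross z v * bracket f g z (z + ε • v) := by
        have := continuous_bracket (N := N); fun_prop
      have h0 := hb.tendsto 0
      rw [zero_smul, add_zero] at h0
      exact h0.mono_left nhdsWithin_le_nhds
    refine h3.congr' ?_
    filter_upwards [self_mem_nhdsWithin] with ε hε
    have hε : ε ≠ 0 := hε
    have h4 := cross_mul_bracket f g z (z + ε • v)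
    have h5 : cross z (z + ε • v) = ε * cross z v := by
      simp only [cross, Pi.add_apply, Pi.smul_apply, smul_eq_mul]; ring
    rw [h5] at h4
    simp only [slope, sub_zero, zero_smul, add_zero, smul_eq_mul, vsub_eq_sub]
    rw [← h4, mul_comm (formEval f z), sub_self, sub_zero, mul_assoc, inv_mul_cancel_left₀ hε]
  exact h2.unique h1

theorem exists_apply_ne_zero {z : Fin 2 → ℂ} (hz : z ≠ 0) : z 0 ≠ 0 ∨ z 1 ≠ 0 := by
  by_contra! h
  exact hz (by ext i; fin_cases i <;> simp [h.1, h.2])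

/-- The Jacobian determinant of two binary forms is a multiple of their bracket on the diagonal. -/
theorem jacobian_eq_bracket {N : ℕ} (f g : BinaryForm N) {z : Fin 2 → ℂ} (hz : z ≠ 0) :
    formDeriv f z (Pi.single 0 1) * formDeriv g z (Pi.single 1 1) -
      formDeriv f z (Pi.single 1 1) * formDeriv g z (Pi.single 0 1) = N * bracket f g z z := by
  have e1 := formDeriv_self f z
  have e2 := formDeriv_self g z
  rw [formDeriv_eq] at e1 e2
  rcases exists_apply_ne_zero hz with h | h
  · have k := cross_mul_bracket_self f g z (Pi.single 1 1)
    refine mul_left_cancel₀ h ?_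
    simp only [cross, Pi.single_eq_same, Pi.single_eq_of_ne (zero_ne_one (α := Fin 2)), mul_one,
      mul_zero, sub_zero] at k
    linear_combination formDeriv g z (Pi.single 1 1) * e1 - formDeriv f z (Pi.single 1 1) * e2 -
      N * k
  · have k := cross_mul_bracket_self f g z (Pi.single 0 1)
    refine mul_left_cancel₀ h ?_
    simp only [cross, Pi.single_eq_same, Pi.single_eq_of_ne (one_ne_zero (α := Fin 2)), mul_one,
      mul_zero, zero_sub] at k
    linear_combination formDeriv f z (Pi.single 0 1) * e2 - formDeriv g z (Pi.single 0 1) * e1 +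
      N * k

/-! ### Degenerate pairs of points -/

theorem not_linearIndependent_pair_iff {ι : Type*} (u v : ι → ℂ) :
    ¬ LinearIndependent ℂ ![u, v] ↔ ∀ i j, u i * v j - v i * u j = 0 := by
  constructor
  · intro h i j
    by_contra hij
    refine h (LinearIndependent.pair_iff.2 fun s t hst => ?_)
    have h1 := congrFun hst i
    have h2 := congrFun hst j
    simp only [Pi.add_apply, Pi.smul_apply, smul_eq_mul, Pi.zero_apply] at h1 h2
    constructor
    · refine (mul_eq_zero.1 ?_).resolve_right hij
      linear_combination v j * h1 - v i * h2
    · refine (mul_eq_zero.1 ?_).resolve_right hij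
      linear_combination u i * h2 - u j * h1
  · intro h hli
    rw [LinearIndependent.pair_iff] at hli
    have h0 (i : ι) := hli (v i) (-u i) (by
      ext j
      simp only [Pi.add_apply, Pi.smul_apply, smul_eq_mul, Pi.zero_apply]
      linear_combination -h i j)
    have hu : u = 0 := by
      ext i; simpa using (h0 i).2
    have := hli 1 0 (by simp [hu])
    simp at this

theorem exists_eq_smul_of_cross_eq_zero {z w : Fin 2 → ℂ} (hz : z ≠ 0) (hw : w ≠ 0)
    (h : cross z w = 0) : ∃ c : ℂ, c ≠ 0 ∧ w = c • z := by
  have key : ∃ c : ℂ, w = c • z := by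
    unfold cross at h
    rcases exists_apply_ne_zero hz with h0 | h0
    · refine ⟨w 0 / z 0, ?_⟩
      ext i; fin_cases i
      · simp [h0]
      · simp only [Fin.mk_one, Pi.smul_apply, smul_eq_mul]
        field_simp
        linear_combination h
    · refine ⟨w 1 / z 1, ?_⟩
      ext i; fin_cases i
      · simp only [Fin.zero_eta, Pi.smul_apply, smul_eq_mul]
        field_simp
        linear_combination -h
      · simp [h0]
  obtain ⟨c, rfl⟩ := key
  exact ⟨c, fun hc => hw (by simp [hc]), rfl⟩

theorem cross_swap (z w : Fin 2 → ℂ) : cross w z = -cross z w := by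
  simp [cross]; ring

theorem ne_zero_of_cross_ne_zero {z w : Fin 2 → ℂ} (h : cross z w ≠ 0) : z ≠ 0 ∧ w ≠ 0 := by
  constructor <;> rintro rfl <;> simp [cross] at h

/-- The pair `z`, `w` is a double point of `γ` or, if the two points coincide, `γ` is not an
immersion there. -/
def Degenerate {k N : ℕ} (γ : RatMap k N) (z w : Fin 2 → ℂ) : Prop :=
  ∀ i j, bracket (γ i) (γ j) z w = 0

theorem degenerate_smul {k N : ℕ} {γ : RatMap k N} {z w : Fin 2 → ℂ} {α β : ℂ} (hα : α ≠ 0)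
    (hβ : β ≠ 0) : Degenerate γ (α • z) (β • w) ↔ Degenerate γ z w := by
  refine forall_congr' fun i => forall_congr' fun j => ?_
  have h := bracket_scale (γ i) (γ j) α β z w
  have h1 : α * β ≠ 0 := mul_ne_zero hα hβ
  constructor
  · intro h0
    rw [h0, mul_zero] at h
    exact (mul_eq_zero.1 h.symm).resolve_left (pow_ne_zero _ h1)
  · intro h0
    rw [h0, mul_zero] at h
    exact (mul_eq_zero.1 h).resolve_left h1

theorem Degenerate.symm {k N : ℕ} {γ : RatMap k N} {z w : Fin 2 → ℂ} (h : Degenerate γ z w) :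
    Degenerate γ w z := fun i j => (bracket_swap _ _ _ _).trans (h i j)

/-- Off the diagonal the brackets are the `2 × 2` minors of the two image vectors, divided by `cross
z w`. -/
theorem degenerate_iff_sameImage {k N : ℕ} {γ : RatMap k N} {z w : Fin 2 → ℂ}
    (h : cross z w ≠ 0) : Degenerate γ z w ↔ SameImage γ z w := by
  rw [SameImage, not_linearIndependent_pair_iff]
  refine forall_congr' fun i => forall_congr' fun j => ?_
  have := cross_mul_bracket (γ i) (γ j) z w
  simp only [ratEval]
  rw [← this, mul_eq_zero, or_iff_right h]

theorem not_immersedAt_iff {k N : ℕ} (γ : RatMap k N) {z : Fin 2 → ℂ} (hz : z ≠ 0) :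
    ¬ ImmersedAt γ z ↔ ∀ i j, N * bracket (γ i) (γ j) z z = 0 := by
  rw [ImmersedAt, not_linearIndependent_pair_iff]
  refine forall_congr' fun i => forall_congr' fun j => ?_
  rw [← jacobian_eq_bracket _ _ hz]
  simp only [partialD_apply]

theorem ImmersedAt.not_degenerate {k N : ℕ} {γ : RatMap k N} {z : Fin 2 → ℂ} (hz : z ≠ 0)
    (h : ImmersedAt γ z) : ¬ Degenerate γ z z := fun hd =>
  (not_immersedAt_iff γ hz).2 (fun i j => by rw [hd i j, mul_zero]) h

/-- Absence of base points comes for free: a point where `γ` vanishes would share its image, in the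
sense of `SameImage`, with every other point. -/
theorem embedded_of_forall_not_degenerate {k N : ℕ} (hN : N ≠ 0) {γ : RatMap k N}
    (h : ∀ z w : Fin 2 → ℂ, z ≠ 0 → w ≠ 0 → ¬ Degenerate γ z w) : Embedded γ := by
  have h2 : ∀ z w : Fin 2 → ℂ, cross z w ≠ 0 → ¬ SameImage γ z w := fun z w hzw hs =>
    h z w (ne_zero_of_cross_ne_zero hzw).1 (ne_zero_of_cross_ne_zero hzw).2
      ((degenerate_iff_sameImage hzw).2 hs)
  refine ⟨fun z hz h0 => ?_, h2, fun z hz => ?_⟩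
  · obtain ⟨w, hw⟩ : ∃ w, cross z w ≠ 0 := by
      rcases exists_apply_ne_zero hz with h0 | h0
      · exact ⟨![0, 1], by simpa [cross]⟩
      · exact ⟨![1, 0], by simpa [cross]⟩
    exact h2 z w hw ((not_linearIndependent_pair_iff _ _).2 fun i j => by simp [h0])
  · by_contra hi
    rw [not_immersedAt_iff γ hz] at hi
    exact h z z hz hz fun i j => (mul_eq_zero.1 (hi i j)).resolve_left (by exact_mod_cast hN)

/-! ### Quadratic forms -/

theorem formEval_two (m : BinaryForm 2) (z : Fin 2 → ℂ) :
    formEval m z = m 0 * z 1 ^ 2 + m 1 * z 0 * z 1 + m 2 * z 0 ^ 2 := by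
  simp [formEval, Fin.sum_univ_three]; ring

theorem formDeriv_two (m : BinaryForm 2) (z w : Fin 2 → ℂ) :
    formDeriv m z w =
      2 * m 0 * z 1 * w 1 + m 1 * (z 0 * w 1 + z 1 * w 0) + 2 * m 2 * z 0 * w 0 := by
  simp [formDeriv, Fin.sum_univ_three]; ring

/-- The two values and the polarization are the coefficients of `m` in the basis `z`, `w`. In
particular, if `m ≠ 0` vanishes at two distinct points, these zeros are simple. -/
theorem eq_zero_of_polar_eq_zero {m : BinaryForm 2} {z w : Fin 2 → ℂ} (h : cross z w ≠ 0)
    (hz : formEval m z = 0) (hw : formEval m w = 0) (hzw : formDeriv m z w = 0) : m = 0 := by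
  rw [formEval_two] at hz hw
  rw [formDeriv_two] at hzw
  unfold cross at h
  have h2 : (m 2 : ℂ) = 0 := by
    refine (mul_eq_zero.1 ?_).resolve_right (pow_ne_zero 2 h)
    linear_combination w 1 ^ 2 * hz - z 1 * w 1 * hzw + z 1 ^ 2 * hw
  have h0 : (m 0 : ℂ) = 0 := by
    refine (mul_eq_zero.1 ?_).resolve_right (pow_ne_zero 2 h)
    linear_combination w 0 ^ 2 * hz - z 0 * w 0 * hzw + z 0 ^ 2 * hw
  have h1 : (m 1 : ℂ) = 0 := by
    refine (mul_eq_zero.1 ?_).resolve_right (pow_ne_zero 2 h)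
    linear_combination -2 * w 0 * w 1 * hz + (z 0 * w 1 + z 1 * w 0) * hzw - 2 * z 0 * z 1 * hw
  ext i
  fin_cases i
  · exact_mod_cast h0
  · exact_mod_cast h1
  · exact_mod_cast h2

theorem eq_smul_of_common_zeros {m δ : BinaryForm 2} {z w : Fin 2 → ℂ} (h : cross z w ≠ 0)
    (hm : m ≠ 0) (hz : formEval m z = 0) (hw : formEval m w = 0) (hz' : formEval δ z = 0)
    (hw' : formEval δ w = 0) : ∃ c : ℝ, δ = c • m := by
  have key (i j : Fin 3) : δ j * m i = m j * δ i := by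
    have hP : formDeriv m z w ≠ 0 := fun hP => hm (eq_zero_of_polar_eq_zero h hz hw hP)
    rw [formEval_two] at hz hw hz' hw'
    -- A quadratic form that vanishes at `z` and `w` is determined by its polar value there: in the
    -- basis `z`, `w` only the mixed coefficient survives.
    have e (μ : BinaryForm 2) (h1 : (μ 0 : ℂ) * z 1 ^ 2 + μ 1 * z 0 * z 1 + μ 2 * z 0 ^ 2 = 0)
        (h2 : (μ 0 : ℂ) * w 1 ^ 2 + μ 1 * w 0 * w 1 + μ 2 * w 0 ^ 2 = 0) (k : Fin 3) :
        (μ k : ℂ) * cross z w ^ 2 = formDeriv μ z w *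
          (![-(z 0 * w 0), z 0 * w 1 + z 1 * w 0, -(z 1 * w 1)] k) := by
      rw [formDeriv_two, cross]
      fin_cases k
      · simp
        linear_combination w 0 ^ 2 * h1 + z 0 ^ 2 * h2
      · simp
        linear_combination -2 * w 0 * w 1 * h1 - 2 * z 0 * z 1 * h2
      · simp
        linear_combination w 1 ^ 2 * h1 + z 1 ^ 2 * h2
    have h3 : (δ j * m i : ℂ) = m j * δ i := by
      refine mul_right_cancel₀ (pow_ne_zero 4 h) ?_
      have e1 := e δ hz' hw'
      have e2 := e m hz hw
      calc (δ j * m i : ℂ) * cross z w ^ 4 = (δ j * cross z w ^ 2) * (m i * cross z w ^ 2) := by ring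
        _ = (m j * cross z w ^ 2) * (δ i * cross z w ^ 2) := by
          rw [e1 j, e2 i, e2 j, e1 i]; ring
        _ = _ := by ring
    exact_mod_cast h3
  obtain ⟨i, hi⟩ := Function.ne_iff.1 hm
  have hi : m i ≠ 0 := hi
  refine ⟨δ i / m i, ?_⟩
  ext j
  rw [Pi.smul_apply, smul_eq_mul]
  field_simp
  linear_combination key i j

/-- The two zeros of a real quadratic form are real or conjugate. -/
theorem exists_realPair_of_ne_zero {m : BinaryForm 2} (hm : m ≠ 0) :
    ∃ x y : Fin 2 → ℂ, x ≠ 0 ∧ y ≠ 0 ∧ IsRealPair x y ∧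
      ∃ k : ℂ, k ≠ 0 ∧ ∀ z, formEval m z = k * (cross z x * cross z y) := by
  by_cases h2 : m 2 = 0
  · refine ⟨![1, 0], ![(m 0 : ℂ), -(m 1 : ℂ)], by simp, ?_, Or.inl fun i => ?_, 1, one_ne_zero,
      fun z => ?_⟩
    · intro h
      have h0 := congrFun h 0
      have h1 := congrFun h 1
      simp at h0 h1
      exact hm (by ext i; fin_cases i <;> simp [h0, h1, h2])
    · fin_cases i <;> simp
    · rw [formEval_two]
      simp [cross, h2]; ring
  · have h2' : (m 2 : ℂ) ≠ 0 := by exact_mod_cast h2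
    have hk : (1 / (4 * m 2) : ℂ) ≠ 0 := by
      refine one_div_ne_zero (mul_ne_zero (by norm_num) h2')
    have key (r : ℂ) (hr : r ^ 2 = m 1 ^ 2 - 4 * m 0 * m 2) (z : Fin 2 → ℂ) :
        formEval m z = 1 / (4 * m 2) *
          (cross z ![-m 1 + r, 2 * m 2] * cross z ![-m 1 - r, 2 * m 2]) := by
      rw [formEval_two]
      simp [cross]
      field_simp
      linear_combination (z 1) ^ 2 * hr
    have hne (r : ℂ) : (![r, 2 * m 2] : Fin 2 → ℂ) ≠ 0 := by
      intro h
      have h1 := congrFun h 1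
      simp [h2] at h1
    rcases le_total 0 (m 1 ^ 2 - 4 * m 0 * m 2) with hD | hD
    · refine ⟨_, _, hne _, hne _, Or.inl fun i => ?_, _, hk,
        key (Real.sqrt (m 1 ^ 2 - 4 * m 0 * m 2) : ℝ) ?_⟩
      · fin_cases i <;> simp
      · have := Real.sq_sqrt hD
        exact_mod_cast this
    · have hD' : 0 ≤ -(m 1 ^ 2 - 4 * m 0 * m 2) := by linarith
      refine ⟨_, _, hne _, hne _, Or.inr fun i => ?_, _, hk,
        key (Complex.I * (Real.sqrt (-(m 1 ^ 2 - 4 * m 0 * m 2)) : ℝ)) ?_⟩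
      · fin_cases i
        · simp [sub_eq_add_neg]
        · simpa using Or.inl (map_ofNat (starRingEnd ℂ) 2).symm
      · have := Real.sq_sqrt hD'
        rw [mul_pow, Complex.I_sq, ← Complex.ofReal_pow, this]
        push_cast; ring

theorem IsRealPair.formDeriv_two_im (m : BinaryForm 2) {z w : Fin 2 → ℂ} (h : IsRealPair z w) :
    (formDeriv m z w).im = 0 := by
  have e : formDeriv m z w = m 0 * (z 1 * w 1 + w 1 * z 1) + m 1 * (z 0 * w 1 + z 1 * w 0) +
      m 2 * (z 0 * w 0 + w 0 * z 0) := by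
    rw [formDeriv_two]; ring
  rw [← Complex.conj_eq_iff_im, e]
  rcases h with h | h
  · have h1 (i : Fin 2) : (starRingEnd ℂ) (z i) = z i := Complex.conj_eq_iff_im.2 (h i).1
    have h2 (i : Fin 2) : (starRingEnd ℂ) (w i) = w i := Complex.conj_eq_iff_im.2 (h i).2
    simp only [map_add, map_mul, h1, h2, Complex.conj_ofReal]
  · simp only [map_add, map_mul, h, Complex.conj_ofReal, Complex.conj_conj]; ring

/-- Proportional real pairs differ by factors whose product is real. -/
theorem IsRealPair.mul_im_eq_zero {x y : Fin 2 → ℂ} {α β : ℂ} (hx : x ≠ 0) (hy : y ≠ 0)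
    (h : IsRealPair x y) (h' : IsRealPair (α • x) (β • y)) : (α * β).im = 0 := by
  -- The polarization of a real quadratic form is real on both pairs, and the two values differ by
  -- the factor `α * β`. Some coordinate form has a nonzero polar value, which forces this factor to
  -- be real.
  have key (m : BinaryForm 2) : (α * β).im * (formDeriv m x y).re = 0 := by
    have h1 := h.formDeriv_two_im m
    have h2 := h'.formDeriv_two_im m
    have h3 : formDeriv m (α • x) (β • y) = α * β * formDeriv m x y := by
      simp only [formDeriv_two, Pi.smul_apply, smul_eq_mul]; ring
    rw [h3, Complex.mul_im, h1] at h2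
    simpa using h2
  by_contra hne
  have hP (m : BinaryForm 2) : formDeriv m x y = 0 :=
    Complex.ext ((mul_eq_zero.1 (key m)).resolve_left hne) (h.formDeriv_two_im m)
  have h0 := hP ![1, 0, 0]
  have h1 := hP ![0, 1, 0]
  have h2 := hP ![0, 0, 1]
  simp [formDeriv_two] at h0 h1 h2
  rcases exists_apply_ne_zero hx with hx0 | hx0
  · have hy0 : y 0 = 0 := h2.resolve_left hx0
    have hy1 : y 1 = 0 := by simpa [hy0, hx0] using h1
    exact hy (by ext i; fin_cases i <;> simp [hy0, hy1])
  · have hy0 : y 1 = 0 := h0.resolve_left hx0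
    have hy1 : y 0 = 0 := by simpa [hy0, hx0] using h1
    exact hy (by ext i; fin_cases i <;> simp [hy0, hy1])

theorem IsRealPair.symm {z w : Fin 2 → ℂ} (h : IsRealPair z w) : IsRealPair w z := by
  rcases h with h | h
  · exact Or.inl fun i => ⟨(h i).2, (h i).1⟩
  · exact Or.inr fun i => by rw [h i, Complex.conj_conj]

theorem isClosed_isRealPair :
    IsClosed {p : (Fin 2 → ℂ) × (Fin 2 → ℂ) | IsRealPair p.1 p.2} := by
  have h1 : IsClosed {p : (Fin 2 → ℂ) × (Fin 2 → ℂ) | ∀ i, (p.1 i).im = 0 ∧ (p.2 i).im = 0} := by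
    simp only [Set.ofPred_forall, Set.ofPred_and]
    exact isClosed_iInter fun i => (isClosed_eq (by fun_prop) (by fun_prop)).inter
      (isClosed_eq (by fun_prop) (by fun_prop))
  have h2 : IsClosed {p : (Fin 2 → ℂ) × (Fin 2 → ℂ) | ∀ i, p.2 i = (starRingEnd ℂ) (p.1 i)} := by
    simp only [Set.ofPred_forall]
    exact isClosed_iInter fun i => isClosed_eq (by fun_prop)
      (Complex.continuous_conj.comp (by fun_prop))
  exact h1.union h2

/-! ### A chart of the space of curves near a nodal or cuspidal curve -/

/-- The triple product of `e`, `Q z` and `Q w`, divided by `cross z w`. -/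
def tripleBracket {n : ℕ} (e : Fin 3 → ℝ) (Q : RatMap 2 n) (z w : Fin 2 → ℂ) : ℂ :=
  e 0 * bracket (Q 1) (Q 2) z w + e 1 * bracket (Q 2) (Q 0) z w + e 2 * bracket (Q 0) (Q 1) z w

/-- The deformations of the lifts of diagrams: the curve `(m Q + s c + b t e : s)`. -/
def deform {n : ℕ} (e : Fin 3 → ℝ) (t : BinaryForm (n + 2))
    (p : Diagram n × (Fin 3 → ℝ) × ℝ) : RatMap 3 (n + 2) :=
  ![formMul (p.1.1 0) p.1.2.2 + p.2.1 0 • p.1.2.1 + (p.2.2 * e 0) • t,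
    formMul (p.1.1 1) p.1.2.2 + p.2.1 1 • p.1.2.1 + (p.2.2 * e 1) • t,
    formMul (p.1.1 2) p.1.2.2 + p.2.1 2 • p.1.2.1 + (p.2.2 * e 2) • t,
    p.1.2.1]

/-- The quantity whose sign distinguishes the two sides of the discriminant. -/
def sideFactor {n : ℕ} (e : Fin 3 → ℝ) (t : BinaryForm (n + 2)) (X : Diagram n)
    (z w : Fin 2 → ℂ) : ℂ :=
  tripleBracket e X.1 z w * bracket t X.2.1 z w

section

variable {n : ℕ} (e : Fin 3 → ℝ) (t : BinaryForm (n + 2))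

theorem deform_castSucc (p : Diagram n × (Fin 3 → ℝ) × ℝ) (i : Fin 3) :
    deform e t p i.castSucc =
      formMul (p.1.1 i) p.1.2.2 + p.2.1 i • p.1.2.1 + (p.2.2 * e i) • t := by
  fin_cases i <;> rfl

theorem deform_last (p : Diagram n × (Fin 3 → ℝ) × ℝ) : deform e t p 3 = p.1.2.1 := rfl

theorem deform_zero (X : Diagram n) : deform e t (X, 0, 0) = lift X := by
  simp [deform, lift]

theorem lift_castSucc (X : Diagram n) (i : Fin 3) :
    lift X i.castSucc = formMul (X.1 i) X.2.2 := by
  fin_cases i <;> rfl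

theorem lift_last (X : Diagram n) : lift X 3 = X.2.1 := rfl

theorem continuous_deform : Continuous (deform e t) := by
  have := continuous_formMul (k := n) (l := 2)
  refine continuous_pi fun i => ?_
  fin_cases i
  · change Continuous fun p : Diagram n × (Fin 3 → ℝ) × ℝ =>
      formMul (p.1.1 0) p.1.2.2 + p.2.1 0 • p.1.2.1 + (p.2.2 * e 0) • t
    fun_prop
  · change Continuous fun p : Diagram n × (Fin 3 → ℝ) × ℝ =>
      formMul (p.1.1 1) p.1.2.2 + p.2.1 1 • p.1.2.1 + (p.2.2 * e 1) • t
    fun_prop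
  · change Continuous fun p : Diagram n × (Fin 3 → ℝ) × ℝ =>
      formMul (p.1.1 2) p.1.2.2 + p.2.1 2 • p.1.2.1 + (p.2.2 * e 2) • t
    fun_prop
  · change Continuous fun p : Diagram n × (Fin 3 → ℝ) × ℝ => p.1.2.1
    fun_prop

theorem continuous_sideFactor :
    Continuous fun p : Diagram n × (Fin 2 → ℂ) × (Fin 2 → ℂ) =>
      sideFactor e t p.1 p.2.1 p.2.2 := by
  have h1 := continuous_bracket (N := n)
  have h2 := continuous_bracket (N := n + 2)
  unfold sideFactor tripleBracket
  fun_prop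

theorem cross_mul_tripleBracket (Q : RatMap 2 n) (z w : Fin 2 → ℂ) :
    cross z w * tripleBracket e Q z w =
      e 0 * (formEval (Q 1) z * formEval (Q 2) w - formEval (Q 1) w * formEval (Q 2) z) +
      e 1 * (formEval (Q 2) z * formEval (Q 0) w - formEval (Q 2) w * formEval (Q 0) z) +
      e 2 * (formEval (Q 0) z * formEval (Q 1) w - formEval (Q 0) w * formEval (Q 1) z) := by
  simp only [tripleBracket, ← cross_mul_bracket]; ring

/-- The vector `m(z) s(w) Q(z) - m(w) s(z) Q(w)` lies in the span of `Q(z)` and `Q(w)`, so its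
triple product with them vanishes. By continuity this survives division by `cross z w ^ 2`. -/
theorem sum_bracket_formMul_mul_bracket {l : ℕ} (Q : RatMap 2 n) (m : BinaryForm l)
    (s : BinaryForm (n + l)) (z w : Fin 2 → ℂ) :
    bracket (formMul (Q 0) m) s z w * bracket (Q 1) (Q 2) z w +
      bracket (formMul (Q 1) m) s z w * bracket (Q 2) (Q 0) z w +
      bracket (formMul (Q 2) m) s z w * bracket (Q 0) (Q 1) z w = 0 := by
  have h1 := continuous_bracket (N := n)
  have h2 := continuous_bracket (N := n + l)
  refine eq_of_eq_of_cross_ne_zero (F := fun p =>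
    bracket (formMul (Q 0) m) s p.1 p.2 * bracket (Q 1) (Q 2) p.1 p.2 +
      bracket (formMul (Q 1) m) s p.1 p.2 * bracket (Q 2) (Q 0) p.1 p.2 +
      bracket (formMul (Q 2) m) s p.1 p.2 * bracket (Q 0) (Q 1) p.1 p.2)
    (G := fun _ => 0) (by fun_prop) continuous_const (fun z w h => ?_) z w
  refine (mul_eq_zero.1 ?_).resolve_left (pow_ne_zero 2 h)
  have e (i : Fin 3) := cross_mul_bracket (formMul (Q i) m) s z w
  simp only [formEval_formMul] at e
  have h12 := cross_mul_bracket (Q 1) (Q 2) z w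
  have h20 := cross_mul_bracket (Q 2) (Q 0) z w
  have h01 := cross_mul_bracket (Q 0) (Q 1) z w
  calc _ = (cross z w * bracket (formMul (Q 0) m) s z w) * (cross z w * bracket (Q 1) (Q 2) z w) +
      (cross z w * bracket (formMul (Q 1) m) s z w) * (cross z w * bracket (Q 2) (Q 0) z w) +
      (cross z w * bracket (formMul (Q 2) m) s z w) * (cross z w * bracket (Q 0) (Q 1) z w) := by
        ring
    _ = 0 := by rw [e 0, e 1, e 2, h12, h20, h01]; ring

/-- The heart of the argument: only the term with the last parameter survives contraction with `Q(z)
× Q(w)`, since the term with `c` already has bracket zero with `s`. So a deformed curve with nonzero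
last parameter can be singular only where the side factor vanishes. -/
theorem Degenerate.mul_sideFactor_eq_zero {p : Diagram n × (Fin 3 → ℝ) × ℝ} {z w : Fin 2 → ℂ}
    (h : Degenerate (deform e t p) z w) : p.2.2 * sideFactor e t p.1 z w = 0 := by
  have key (i : Fin 3) : bracket (formMul (p.1.1 i) p.1.2.2) p.1.2.1 z w =
      -(p.2.2 * e i * bracket t p.1.2.1 z w) := by
    have := h i.castSucc 3
    rw [deform_castSucc, deform_last, bracket_add_left, bracket_add_left, bracket_smul_left,
      bracket_smul_left, bracket_self] at this
    push_cast at this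
    linear_combination this
  have := sum_bracket_formMul_mul_bracket p.1.1 p.1.2.2 p.1.2.1 z w
  rw [key, key, key] at this
  rw [sideFactor, tripleBracket]
  linear_combination -this

/-- The degrees `n - 1` and `n + 1` of the two factors have the same parity, so the side factor
scales by an even power of `α * β`. Its sign thus does not depend on the real representatives of a
pair. -/
theorem sideFactor_smul (X : Diagram n) (α β : ℂ) (z w : Fin 2 → ℂ) :
    (α * β) ^ 2 * sideFactor e t X (α • z) (β • w) =
      ((α * β) ^ (n + 1)) ^ 2 * sideFactor e t X z w := by
  have h1 : α * β * tripleBracket e X.1 (α • z) (β • w) =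
      (α * β) ^ n * tripleBracket e X.1 z w := by
    have := bracket_scale (X.1 1) (X.1 2) α β z w
    have h2 := bracket_scale (X.1 2) (X.1 0) α β z w
    have h3 := bracket_scale (X.1 0) (X.1 1) α β z w
    unfold tripleBracket
    linear_combination e 0 * this + e 1 * h2 + e 2 * h3
  have h2 := bracket_scale t X.2.1 α β z w
  unfold sideFactor
  calc _ = (α * β * tripleBracket e X.1 (α • z) (β • w)) *
        (α * β * bracket t X.2.1 (α • z) (β • w)) := by ring
    _ = _ := by rw [h1, h2]; ring

theorem sideFactor_swap (X : Diagram n) (z w : Fin 2 → ℂ) :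
    sideFactor e t X w z = sideFactor e t X z w := by
  simp only [sideFactor, tripleBracket, bracket_swap _ _ z w]

theorem sideFactor_re_pos_smul {X : Diagram n} {α β : ℂ} {z w : Fin 2 → ℂ} (h0 : α * β ≠ 0)
    (hr : (α * β).im = 0) (h : 0 < (sideFactor e t X z w).re) :
    0 < (sideFactor e t X (α • z) (β • w)).re := by
  have h1 := congrArg Complex.re (sideFactor_smul e t X α β z w)
  obtain ⟨r, hr⟩ : ∃ r : ℝ, α * β = r := ⟨(α * β).re, Complex.ext (by simp) (by simpa using hr)⟩
  rw [hr] at h0 h1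
  have h0 : r ≠ 0 := by exact_mod_cast h0
  simp only [← Complex.ofReal_pow, Complex.re_ofReal_mul] at h1
  have h2 : 0 < r ^ 2 * (sideFactor e t X (α • z) (β • w)).re := by rw [h1]; positivity
  exact pos_of_mul_pos_right h2 (by positivity)

end

/-! ### Choice of the directions `e` and `t` -/

/-- A Plücker relation: three vectors in a plane, the values of the forms at `z` and `w`, are
dependent. -/
theorem bracket_cyclic {N : ℕ} (f g h : BinaryForm N) (z w : Fin 2 → ℂ) :
    formEval f z * bracket g h z w + formEval g z * bracket h f z w +
      formEval h z * bracket f g z w = 0 := by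
  have h1 := continuous_bracket (N := N)
  have h2 := continuous_formEval (N := N)
  refine eq_of_eq_of_cross_ne_zero (F := fun p =>
    formEval f p.1 * bracket g h p.1 p.2 + formEval g p.1 * bracket h f p.1 p.2 +
      formEval h p.1 * bracket f g p.1 p.2) (G := fun _ => 0) (by fun_prop) continuous_const
    (fun z w hc => ?_) z w
  refine (mul_eq_zero.1 ?_).resolve_left hc
  linear_combination formEval f z * cross_mul_bracket g h z w +
    formEval g z * cross_mul_bracket h f z w + formEval h z * cross_mul_bracket f g z w

theorem bracket_single {N : ℕ} (i j : Fin (N + 1)) (z w : Fin 2 → ℂ) :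
    bracket (Pi.single i 1) (Pi.single j 1) z w = bracketMonomial N i j z w := by
  unfold bracket
  rw [Finset.sum_eq_single i, Finset.sum_eq_single j]
  · simp
  · intro j' _ h; simp [h]
  · simp
  · intro i' _ h; simp [h]
  · simp

theorem exists_bracket_ne_zero {N : ℕ} (hN : N ≠ 0) {z w : Fin 2 → ℂ} (hz : z ≠ 0) (hw : w ≠ 0) :
    ∃ f g : BinaryForm N, bracket f g z w ≠ 0 := by
  obtain ⟨N, rfl⟩ := Nat.exists_eq_succ_of_ne_zero hN
  have red (i j : Fin (N + 2)) (h : bracketMonomial (N + 1) i j z w ≠ 0) :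
      ∃ f g : BinaryForm (N + 1), bracket f g z w ≠ 0 :=
    ⟨Pi.single i 1, Pi.single j 1, by rwa [bracket_single]⟩
  -- If neither point is at infinity, or neither at zero, two neighbouring monomials at the
  -- appropriate end suffice. Otherwise one point is zero and the other infinity, and the two
  -- extreme monomials are needed.
  by_cases h1 : z 1 * w 1 = 0
  · by_cases h0 : z 0 * w 0 = 0
    · refine red (Fin.last _) 0 ?_
      have hz' := exists_apply_ne_zero hz
      have hw' := exists_apply_ne_zero hw
      simp only [Fin.val_last, Fin.val_zero, bracketMonomial]
      rcases mul_eq_zero.1 h0 with h0 | h0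
      · have hz1 := hz'.resolve_left (not_not.2 h0)
        have hw1 := (mul_eq_zero.1 h1).resolve_left hz1
        have hw0 := hw'.resolve_right (not_not.2 hw1)
        simp [h0, hz1, hw1, hw0, zero_pow_eq]
      · have hw1 := hw'.resolve_left (not_not.2 h0)
        have hz1 := (mul_eq_zero.1 h1).resolve_right hw1
        have hz0 := hz'.resolve_right (not_not.2 hz1)
        simp [h0, hz1, Finset.sum_range_succ]
        rw [Finset.sum_eq_zero]
        · simp [hz0, hw1]
        · intro r hr
          rw [zero_pow (by have := Finset.mem_range.1 hr; omega), mul_zero]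
    · refine red (Fin.last _) (Fin.last N).castSucc ?_
      simpa [bracketMonomial] using pow_ne_zero N h0
  · refine red (Fin.succ 0) 0 ?_
    simpa [bracketMonomial] using pow_ne_zero N h1

/-- If `s` had zero bracket with every form, `bracket_cyclic` and `s(z) ≠ 0` would make all brackets
at `z`, `w` vanish. The nonzero value obtained is real, and changing the sign of `t` makes it
positive. -/
theorem exists_bracket_pos {N : ℕ} (hN : N ≠ 0) {s : BinaryForm N} {z w : Fin 2 → ℂ} (hz : z ≠ 0)
    (hw : w ≠ 0) (hzw : IsRealPair z w) (hs : formEval s z ≠ 0) :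
    ∃ t : BinaryForm N, 0 < (bracket t s z w).re := by
  obtain ⟨t, ht⟩ : ∃ t : BinaryForm N, bracket t s z w ≠ 0 := by
    by_contra! h
    obtain ⟨f, g, hfg⟩ := exists_bracket_ne_zero hN hz hw
    have h1 := bracket_cyclic s f g z w
    rw [h g, bracket_anticomm f s, h f] at h1
    simp [hs, hfg] at h1
  have hre : (bracket t s z w).re ≠ 0 := fun h0 =>
    ht (Complex.ext h0 (hzw.bracket_im t s))
  rcases hre.lt_or_gt with h | h
  · refine ⟨(-1 : ℝ) • t, ?_⟩
    rw [bracket_smul_left]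
    simpa using h
  · exact ⟨t, h⟩

theorem exists_tripleBracket_pos {n : ℕ} {Q : RatMap 2 n} {z w : Fin 2 → ℂ}
    (hzw : IsRealPair z w) (h : ¬ Degenerate Q z w) :
    ∃ e : Fin 3 → ℝ, 0 < (tripleBracket e Q z w).re := by
  by_contra! h0
  apply h
  have hre (i j : Fin 3) (hij : (bracket (Q i) (Q j) z w).re = 0) : bracket (Q i) (Q j) z w = 0 :=
    Complex.ext hij (hzw.bracket_im _ _)
  -- Taking for `e` the real parts of the three brackets turns the triple bracket into a sum of
  -- squares.
  have hsq := h0 ![(bracket (Q 1) (Q 2) z w).re, (bracket (Q 2) (Q 0) z w).re,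
    (bracket (Q 0) (Q 1) z w).re]
  simp [tripleBracket] at hsq
  have sq {a b c : ℝ} (h : a * a + b * b + c * c ≤ 0) : a = 0 ∧ b = 0 ∧ c = 0 :=
    ⟨by nlinarith [sq_nonneg a, sq_nonneg b, sq_nonneg c],
      by nlinarith [sq_nonneg a, sq_nonneg b, sq_nonneg c],
      by nlinarith [sq_nonneg a, sq_nonneg b, sq_nonneg c]⟩
  have h12 := hre 1 2 (sq hsq).1
  have h20 := hre 2 0 (sq hsq).2.1
  have h01 := hre 0 1 (sq hsq).2.2
  have h21 : bracket (Q 2) (Q 1) z w = 0 := by rw [bracket_anticomm, h12, neg_zero]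
  have h02 : bracket (Q 0) (Q 2) z w = 0 := by rw [bracket_anticomm, h20, neg_zero]
  have h10 : bracket (Q 1) (Q 0) z w = 0 := by rw [bracket_anticomm, h01, neg_zero]
  intro i j
  match i, j with
  | 0, 0 => exact bracket_self _ _ _
  | 0, 1 => exact h01
  | 0, 2 => exact h02
  | 1, 0 => exact h10
  | 1, 1 => exact bracket_self _ _ _
  | 1, 2 => exact h12
  | 2, 0 => exact h20
  | 2, 1 => exact h21
  | 2, 2 => exact bracket_self _ _ _

/-! ### The central diagram of a move -/

/-- The properties of the central diagram of a move: `K'` is nonsingular outside `p`, and at `p` it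
has a node or a cusp. -/
structure IsCentral {n : ℕ} (X : Diagram n) : Prop where
  basePointFree : BasePointFree X.1
  disjointDivisors : DisjointDivisors X.2.1 X.2.2
  ne_zero : X.2.2 ≠ 0
  smoothOffVertex : SmoothOffVertex X
  not_sameImage : ∀ x y : Fin 2 → ℂ, cross x y ≠ 0 → formEval X.2.2 x = 0 → formEval X.2.2 y = 0 →
    ¬ SameImage X.1 x y
  immersedAt : ∀ x : Fin 2 → ℂ, x ≠ 0 → formEval X.2.2 x = 0 → ImmersedAt X.1 x

theorem SmoothOffVertex.eq_zero_of_degenerate {n : ℕ} {X : Diagram n} (hX : SmoothOffVertex X)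
    {z w : Fin 2 → ℂ} (hz : z ≠ 0) (hw : w ≠ 0) (h : Degenerate (lift X) z w) :
    formEval X.2.2 z = 0 := by
  by_contra hm
  obtain ⟨h1, h2⟩ := hX z hz hm
  by_cases hc : cross z w = 0
  · obtain ⟨c, hc0, rfl⟩ := exists_eq_smul_of_cross_eq_zero hz hw hc
    refine h1.not_degenerate hz ?_
    rw [← degenerate_smul one_ne_zero hc0, one_smul]
    exact h
  · exact h2 w hc ((degenerate_iff_sameImage hc).1 h)

/-- At a simple zero of `m` the curve passes through `p` with velocity a nonzero multiple of `Q(x)`,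
so the branch is immersed. -/
theorem IsCentral.not_degenerate_of_cross_ne_zero {n : ℕ} {X : Diagram n} (hX : IsCentral X)
    {x y : Fin 2 → ℂ} (hc : cross x y ≠ 0) (hx : formEval X.2.2 x = 0) (hy : formEval X.2.2 y = 0) :
    ¬ Degenerate (lift X) x x := by
  intro h
  have hx0 := (ne_zero_of_cross_ne_zero hc).1
  refine hX.basePointFree x hx0 ?_
  ext i
  have h1 := cross_mul_bracket_self (lift X i.castSucc) (lift X 3) x y
  rw [h, lift_castSucc, lift_last, formDeriv_formMul, formEval_formMul, hx] at h1
  have hs : formEval X.2.1 x ≠ 0 := fun hs => hX.disjointDivisors x hx0 ⟨hs, hx⟩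
  have hP : formDeriv X.2.2 x y ≠ 0 := fun hP =>
    hX.ne_zero (eq_zero_of_polar_eq_zero hc hx hy hP)
  have h2 : formEval (X.1 i) x * (formDeriv X.2.2 x y * formEval X.2.1 x) = 0 := by
    linear_combination h1
  exact (mul_eq_zero.1 h2).resolve_right (mul_ne_zero hP hs)

/-- The pair consists of the two zeros of `m`, equal in the cuspidal case. Any degenerate pair of
the lift consists of zeros of `m`; when these are distinct, each branch is immersed and the pair
must contain both. -/
theorem IsCentral.exists_realPair {n : ℕ} {X : Diagram n} (hX : IsCentral X) :
    ∃ x y : Fin 2 → ℂ, x ≠ 0 ∧ y ≠ 0 ∧ IsRealPair x y ∧ formEval X.2.1 x ≠ 0 ∧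
      ¬ Degenerate X.1 x y ∧
      ∀ z w : Fin 2 → ℂ, z ≠ 0 → w ≠ 0 → Degenerate (lift X) z w → ∃ α β : ℂ, α * β ≠ 0 ∧
        ((z = α • x ∧ w = β • y) ∨ (w = α • x ∧ z = β • y)) := by
  obtain ⟨x, y, hx, hy, hxy, k, hk, hm⟩ := exists_realPair_of_ne_zero hX.ne_zero
  have hself (v : Fin 2 → ℂ) : cross v v = 0 := by simp [cross, mul_comm]
  have hmx : formEval X.2.2 x = 0 := by simp [hm, hself]
  have hmy : formEval X.2.2 y = 0 := by simp [hm, hself]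
  refine ⟨x, y, hx, hy, hxy, fun hs => hX.disjointDivisors x hx ⟨hs, hmx⟩, ?_, ?_⟩
  · intro h
    by_cases hc : cross x y = 0
    · obtain ⟨c, hc0, rfl⟩ := exists_eq_smul_of_cross_eq_zero hx hy hc
      refine (hX.immersedAt x hx hmx).not_degenerate hx ?_
      rw [← degenerate_smul one_ne_zero hc0, one_smul]
      exact h
    · exact hX.not_sameImage x y hc hmx hmy ((degenerate_iff_sameImage hc).1 h)
  · intro z w hz hw h
    have h1 := hX.smoothOffVertex.eq_zero_of_degenerate hz hw h
    have h2 := hX.smoothOffVertex.eq_zero_of_degenerate hw hz h.symm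
    have cases {v : Fin 2 → ℂ} (h : formEval X.2.2 v = 0) : cross x v = 0 ∨ cross y v = 0 := by
      rw [hm, cross_swap x v, cross_swap y v] at h
      simpa [hk] using h
    have fin {z w : Fin 2 → ℂ} (hz : z ≠ 0) (hw : w ≠ 0) (h1 : cross x z = 0) (h2 : cross y w = 0) :
        ∃ α β : ℂ, α * β ≠ 0 ∧ (z = α • x ∧ w = β • y) := by
      obtain ⟨α, hα, h3⟩ := exists_eq_smul_of_cross_eq_zero hx hz h1
      obtain ⟨β, hβ, h4⟩ := exists_eq_smul_of_cross_eq_zero hy hw h2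
      exact ⟨α, β, mul_ne_zero hα hβ, h3, h4⟩
    by_cases hc : cross x y = 0
    · obtain ⟨c, hc0, rfl⟩ := exists_eq_smul_of_cross_eq_zero hx hy hc
      have e (v : Fin 2 → ℂ) : cross (c • x) v = c * cross x v := by simp [cross]; ring
      simp only [e, mul_eq_zero, hc0, false_or, or_self] at cases
      obtain ⟨α, β, h0, h3⟩ := fin hz hw (cases h1) (by rw [e, cases h2, mul_zero])
      exact ⟨α, β, h0, Or.inl h3⟩
    · have no {x y : Fin 2 → ℂ} (hc : cross x y ≠ 0) (hmx : formEval X.2.2 x = 0)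
          (hmy : formEval X.2.2 y = 0) (h3 : cross x z = 0) (h4 : cross x w = 0) : False := by
        have hx := (ne_zero_of_cross_ne_zero hc).1
        obtain ⟨α, hα, rfl⟩ := exists_eq_smul_of_cross_eq_zero hx hz h3
        obtain ⟨β, hβ, rfl⟩ := exists_eq_smul_of_cross_eq_zero hx hw h4
        exact hX.not_degenerate_of_cross_ne_zero hc hmx hmy ((degenerate_smul hα hβ).1 h)
      rcases cases h1 with h3 | h3 <;> rcases cases h2 with h4 | h4
      · exact (no hc hmx hmy h3 h4).elim
      · obtain ⟨α, β, h0, h5⟩ := fin hz hw h3 h4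
        exact ⟨α, β, h0, Or.inl h5⟩
      · obtain ⟨α, β, h0, h5⟩ := fin hw hz h4 h3
        exact ⟨α, β, h0, Or.inr h5⟩
      · exact (no (by rw [cross_swap]; exact neg_ne_zero.2 hc) hmy hmx h3 h4).elim

/-- A chart adapted to the central diagram: the side factor is nonzero at its double point, and
positive with respect to real representatives. -/
theorem IsCentral.exists_chart {n : ℕ} {X : Diagram n} (hX : IsCentral X) :
    ∃ (e : Fin 3 → ℝ) (t : BinaryForm (n + 2)), ∀ z w : Fin 2 → ℂ, z ≠ 0 → w ≠ 0 →
      Degenerate (lift X) z w →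
        sideFactor e t X z w ≠ 0 ∧ (IsRealPair z w → 0 < (sideFactor e t X z w).re) := by
  obtain ⟨x, y, hx, hy, hxy, hs, hQ, h⟩ := hX.exists_realPair
  obtain ⟨e, he⟩ := exists_tripleBracket_pos hxy hQ
  obtain ⟨t, ht⟩ := exists_bracket_pos (by omega) hx hy hxy hs
  have hpos : 0 < (sideFactor e t X x y).re := by
    rw [sideFactor, Complex.mul_re, hxy.bracket_im, mul_zero, sub_zero]
    exact mul_pos he ht
  have hne : sideFactor e t X x y ≠ 0 := fun h0 => by simp [h0] at hpos
  have key (α β : ℂ) (h0 : α * β ≠ 0) : sideFactor e t X (α • x) (β • y) ≠ 0 ∧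
      (IsRealPair (α • x) (β • y) → 0 < (sideFactor e t X (α • x) (β • y)).re) := by
    refine ⟨fun h1 => ?_, fun hr => ?_⟩
    · have := sideFactor_smul e t X α β x y
      rw [h1, mul_zero] at this
      exact mul_ne_zero (pow_ne_zero _ (pow_ne_zero _ h0)) hne this.symm
    · exact sideFactor_re_pos_smul e t h0 (hxy.mul_im_eq_zero hx hy hr) hpos
  refine ⟨e, t, fun z w hz hw hd => ?_⟩
  obtain ⟨α, β, h0, ⟨rfl, rfl⟩ | ⟨rfl, rfl⟩⟩ := h z w hz hw hd
  · exact key α β h0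
  · rw [sideFactor_swap]
    exact ⟨(key α β h0).1, fun hr => (key α β h0).2 hr.symm⟩

/-! ### The sign of a crossing -/

/-- The determinant of three vectors. -/
def tripleProduct (a b c : Fin 3 → ℂ) : ℂ :=
  a 0 * (b 1 * c 2 - c 1 * b 2) + a 1 * (b 2 * c 0 - c 2 * b 0) + a 2 * (b 0 * c 1 - c 0 * b 1)

theorem cross_mul_tripleBracket_eq {n : ℕ} (e : Fin 3 → ℝ) (Q : RatMap 2 n) (z w : Fin 2 → ℂ) :
    cross z w * tripleBracket e Q z w =
      tripleProduct (fun i => (e i : ℂ)) (ratEval Q z) (ratEval Q w) := by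
  rw [cross_mul_tripleBracket]; rfl

theorem mem_span_pair_of_tripleProduct_eq_zero {a b c : Fin 3 → ℂ}
    (hbc : LinearIndependent ℂ ![b, c]) (h : tripleProduct a b c = 0) :
    a ∈ Submodule.span ℂ {b, c} := by
  by_contra ha
  have hli : LinearIndependent ℂ ![a, b, c] := by
    refine linearIndependent_finCons.2 ⟨hbc, ?_⟩
    simpa [Matrix.range_cons, Matrix.range_empty, Set.pair_comm] using ha
  have hu := (Matrix.linearIndependent_rows_iff_isUnit (A := Matrix.of ![a, b, c])).1 hli
  rw [Matrix.isUnit_iff_isUnit_det] at hu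
  refine hu.ne_zero ?_
  rw [Matrix.det_fin_three]
  simp only [tripleProduct] at h
  simp
  linear_combination h

/-- Used with `o` on the chord through the images of `z` and `w`: by Euler's relation these are
combinations of the partial derivatives, so `o` can replace one row of the crossing determinant. -/
theorem det_four_of_smul_add (A B C D o : Fin 4 → ℂ) (z w : Fin 2 → ℂ) (d l r : ℂ)
    (h : ∀ j, d * o j = l * (z 0 * A j + z 1 * B j) + r * (w 0 * C j + w 1 * D j)) :
    l * (cross z w * Matrix.det (Matrix.of ![A, B, C, D])) =
      d * Matrix.det (Matrix.of ![o, w 0 • A + w 1 • B, C, D]) := by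
  have h1 : d * Matrix.det (Matrix.of ![o, w 0 • A + w 1 • B, C, D]) =
      Matrix.det (Matrix.of ![d • o, w 0 • A + w 1 • B, C, D]) := by
    simp [Matrix.det_succ_row_zero, Fin.sum_univ_succ, Fin.succAbove]
    ring
  have h2 : d • o = l • (z 0 • A + z 1 • B) + r • (w 0 • C + w 1 • D) := funext h
  rw [h1, h2]
  simp [Matrix.det_succ_row_zero, Fin.sum_univ_succ, Fin.succAbove, cross]
  ring

theorem det_four_of_jacobian (o A C D : Fin 4 → ℂ) (a c : Fin 3 → ℂ) (P m₀ m₁ : ℂ)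
    (hA : ∀ i : Fin 3, A i.castSucc = P * a i) (hC : ∀ i : Fin 3, C i.castSucc = m₀ * c i)
    (hD : ∀ i : Fin 3, D i.castSucc = m₁ * c i) :
    Matrix.det (Matrix.of ![o, A, C, D]) =
      P * (m₀ * D 3 - m₁ * C 3) * tripleProduct (fun i => o i.castSucc) a c := by
  have hA0 : A 0 = P * a 0 := hA 0
  have hA1 : A 1 = P * a 1 := hA 1
  have hA2 : A 2 = P * a 2 := hA 2
  have hC0 : C 0 = m₀ * c 0 := hC 0
  have hC1 : C 1 = m₀ * c 1 := hC 1
  have hC2 : C 2 = m₀ * c 2 := hC 2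
  have hD0 : D 0 = m₁ * c 0 := hD 0
  have hD1 : D 1 = m₁ * c 1 := hD 1
  have hD2 : D 2 = m₁ * c 2 := hD 2
  have e : (Fin.castSucc 2 : Fin 4) = 2 := rfl
  simp [Matrix.det_succ_row_zero, Fin.sum_univ_succ, Fin.succAbove, tripleProduct, e, hA0, hA1, hA2,
    hC0, hC1, hC2, hD0, hD1, hD2]
  ring

section

variable {n : ℕ} (e : Fin 3 → ℝ) (t : BinaryForm (n + 2)) (o : Fin 4 → ℝ)

/-- The numerator in the expression for the determinant of a crossing seen from `o`. -/
def crossingNumerator (p : Diagram n × (Fin 3 → ℝ) × ℝ) (z w : Fin 2 → ℂ) : ℂ :=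
  ((n + 2 : ℕ) : ℂ) * Matrix.det (Matrix.of ![(fun i => (o i : ℂ)),
    (fun j => formDeriv (deform e t p j) z w), partialD (deform e t p) w 0,
    partialD (deform e t p) w 1])

/-- The denominator in the expression for the determinant of a crossing seen from `o`. -/
def crossingDenominator (p : Diagram n × (Fin 3 → ℝ) × ℝ) (z w : Fin 2 → ℂ) : ℂ :=
  formEval p.1.2.1 w * tripleProduct (fun i => (o i.castSucc : ℂ) - o 3 * p.2.1 i)
      (ratEval p.1.1 z) (ratEval p.1.1 w) -
    p.2.2 * (cross z w * tripleBracket e p.1.1 z w) * o 3 * formEval t w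

theorem continuous_crossingNumerator :
    Continuous fun x : (Diagram n × (Fin 3 → ℝ) × ℝ) × (Fin 2 → ℂ) × (Fin 2 → ℂ) =>
      crossingNumerator e t o x.1 x.2.1 x.2.2 := by
  have h1 := continuous_deform e t
  have h2 := continuous_formDeriv (N := n + 2)
  refine continuous_const.mul (Continuous.matrix_det (continuous_matrix fun i j => ?_))
  have h3 : Continuous fun x : (Diagram n × (Fin 3 → ℝ) × ℝ) × (Fin 2 → ℂ) × (Fin 2 → ℂ) =>
      deform e t x.1 j := by fun_prop
  fin_cases i
  · exact continuous_const
  · change Continuous fun x : (Diagram n × (Fin 3 → ℝ) × ℝ) × (Fin 2 → ℂ) × (Fin 2 → ℂ) =>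
      formDeriv (deform e t x.1 j) x.2.1 x.2.2
    fun_prop
  · change Continuous fun x : (Diagram n × (Fin 3 → ℝ) × ℝ) × (Fin 2 → ℂ) × (Fin 2 → ℂ) =>
      partialD (deform e t x.1) x.2.2 0 j
    simp only [partialD_apply]
    fun_prop
  · change Continuous fun x : (Diagram n × (Fin 3 → ℝ) × ℝ) × (Fin 2 → ℂ) × (Fin 2 → ℂ) =>
      partialD (deform e t x.1) x.2.2 1 j
    simp only [partialD_apply]
    fun_prop

theorem continuous_crossingDenominator :
    Continuous fun x : (Diagram n × (Fin 3 → ℝ) × ℝ) × (Fin 2 → ℂ) × (Fin 2 → ℂ) =>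
      crossingDenominator e t o x.1 x.2.1 x.2.2 := by
  have h1 := continuous_formEval (N := n)
  have h2 := continuous_formEval (N := n + 2)
  have h3 := continuous_bracket (N := n)
  have h4 := continuous_cross
  unfold crossingDenominator tripleProduct tripleBracket ratEval
  fun_prop

/-- The point `o` is `l` times the image of `z` plus `r` times that of `w`, and `l`, `r` may blow up
as the two images merge. Both are eliminated, which leaves an identity with continuous terms and the
last parameter as an explicit factor. -/
theorem crossingDet_mul_denominator {p : Diagram n × (Fin 3 → ℝ) × ℝ} {z w : Fin 2 → ℂ}
    (h : (fun i => (o i : ℂ)) ∈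
      Submodule.span ℂ {ratEval (deform e t p) z, ratEval (deform e t p) w}) :
    crossingDet (deform e t p) z w * (cross z w * crossingDenominator e t o p z w) =
      p.2.2 * (crossingNumerator e t o p z w * (cross z w ^ 2 * sideFactor e t p.1 z w)) := by
  obtain ⟨l, r, h⟩ := Submodule.mem_span_pair.1 h
  have ho (j : Fin 4) : l * formEval (deform e t p j) z + r * formEval (deform e t p j) w = o j :=
    congrFun h j
  have h1 : l * (cross z w * crossingDet (deform e t p) z w) = crossingNumerator e t o p z w := by
    have h2 := det_four_of_smul_add (partialD (deform e t p) z 0) (partialD (deform e t p) z 1)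
      (partialD (deform e t p) w 0) (partialD (deform e t p) w 1) (fun i => (o i : ℂ)) z w
      ((n + 2 : ℕ) : ℂ) l r (fun j => by
        simp only [partialD_apply, ← formDeriv_eq, formDeriv_self, ← ho]; ring)
    have h3 : w 0 • partialD (deform e t p) z 0 + w 1 • partialD (deform e t p) z 1 =
        fun j => formDeriv (deform e t p j) z w := by
      ext j
      rw [formDeriv_eq (deform e t p j)]
      simp [partialD_apply]
    rw [h3] at h2
    exact h2
  have h2 : crossingDenominator e t o p z w =
      p.2.2 * l * (cross z w ^ 2 * sideFactor e t p.1 z w) := by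
    have h3 := ho 3
    rw [deform_last] at h3
    have h4 (i : Fin 3) : (o i.castSucc : ℂ) - o 3 * p.2.1 i =
        l * (formEval (p.1.1 i) z * formEval p.1.2.2 z + p.2.2 * e i * formEval t z) +
        r * (formEval (p.1.1 i) w * formEval p.1.2.2 w + p.2.2 * e i * formEval t w) := by
      have := ho i.castSucc
      simp only [deform_castSucc, formEval_add, formEval_smul, formEval_formMul] at this
      push_cast at this
      linear_combination -this + p.2.1 i * h3
    have h5 := cross_mul_tripleBracket_eq e p.1.1 z w
    have h6 := cross_mul_bracket t p.1.2.1 z w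
    -- The shear by `c` has been undone in `h4`; the triple product then kills the terms along
    -- `Q(z)` and `Q(w)`. The relation `h3` for the last coordinate subsequently eliminates `r`.
    have h7 : tripleProduct (fun i => (o i.castSucc : ℂ) - o 3 * p.2.1 i)
        (ratEval p.1.1 z) (ratEval p.1.1 w) = p.2.2 * (l * formEval t z + r * formEval t w) *
          tripleProduct (fun i => (e i : ℂ)) (ratEval p.1.1 z) (ratEval p.1.1 w) := by
      simp only [tripleProduct, h4, ratEval]
      ring
    rw [crossingDenominator, h7, h5, sideFactor]
    rw [← h5, ← h3]
    linear_combination (-p.2.2 * l * cross z w * tripleBracket e p.1.1 z w) * h6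
  rw [h2, ← h1]
  ring

/-- Both tangents pass through `p`, so together they span the preimage of the line through `Q(a)`
and `Q(b)`. A point `o` outside this plane projects outside that line. -/
theorem tripleProduct_ne_zero_of_notMem {X : Diagram n} {a b : Fin 2 → ℂ}
    (hd : DisjointDivisors X.2.1 X.2.2) (hm : X.2.2 ≠ 0)
    (hab : cross a b ≠ 0) (ha : formEval X.2.2 a = 0) (hb : formEval X.2.2 b = 0)
    (hq : ¬ SameImage X.1 a b)
    (ho : (fun i => (o i : ℂ)) ∉ tangentLine (lift X) a ⊔ tangentLine (lift X) b) :
    tripleProduct (fun i => (o i.castSucc : ℂ)) (ratEval X.1 a) (ratEval X.1 b) ≠ 0 := by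
  intro h0
  have h1 := mem_span_pair_of_tripleProduct_eq_zero (not_not.1 hq) h0
  obtain ⟨l, r, h1⟩ := Submodule.mem_span_pair.1 h1
  let E : Fin 4 → ℂ := ![0, 0, 0, 1]
  let V (z : Fin 2 → ℂ) : Fin 4 → ℂ :=
    ![formEval (X.1 0) z, formEval (X.1 1) z, formEval (X.1 2) z, 0]
  have hD (z v : Fin 2 → ℂ) : (fun j => formDeriv (lift X j) z v) ∈ tangentLine (lift X) z := by
    refine Submodule.mem_span_pair.2 ⟨v 0, v 1, ?_⟩
    ext j
    rw [formDeriv_eq]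
    simp [partialD_apply]
  have hdec (z v : Fin 2 → ℂ) (hz : formEval X.2.2 z = 0) :
      (fun j => formDeriv (lift X j) z v) =
        formDeriv X.2.2 z v • V z + formDeriv X.2.1 z v • E := by
    have hi (i : Fin 3) : formDeriv (lift X i.castSucc) z v =
        formDeriv X.2.2 z v * formEval (X.1 i) z := by
      rw [lift_castSucc, formDeriv_formMul, hz]; ring
    ext j
    refine Fin.lastCases ?_ (fun i => ?_) j
    · change formDeriv X.2.1 z v = _
      simp [V, E, Fin.last]
    · rw [hi]
      fin_cases i <;> simp [V, E]
  have hEV (z v : Fin 2 → ℂ) (hz0 : z ≠ 0) (hz : formEval X.2.2 z = 0)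
      (hP : formDeriv X.2.2 z v ≠ 0) : E ∈ tangentLine (lift X) z ∧ V z ∈ tangentLine (lift X) z := by
    have hs : formEval X.2.1 z ≠ 0 := fun hs => hd z hz0 ⟨hs, hz⟩
    have h2 := hD z z
    rw [hdec z z hz, formDeriv_self, formDeriv_self, hz, mul_zero, zero_smul, zero_add] at h2
    have hE : E ∈ tangentLine (lift X) z :=
      (Submodule.smul_mem_iff _ (mul_ne_zero (Nat.cast_ne_zero.2 (by omega)) hs)).1 h2
    have h3 := hD z v
    rw [hdec z v hz] at h3
    exact ⟨hE, (Submodule.smul_mem_iff _ hP).1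
      ((Submodule.add_mem_iff_left _ (Submodule.smul_mem _ _ hE)).1 h3)⟩
  have hPa : formDeriv X.2.2 a b ≠ 0 := fun hP => hm (eq_zero_of_polar_eq_zero hab ha hb hP)
  have hPb : formDeriv X.2.2 b a ≠ 0 := fun hP =>
    hm (eq_zero_of_polar_eq_zero (by rw [cross_swap]; exact neg_ne_zero.2 hab) hb ha hP)
  have hA := hEV a b (ne_zero_of_cross_ne_zero hab).1 ha hPa
  have hB := hEV b a (ne_zero_of_cross_ne_zero hab).2 hb hPb
  apply ho
  have hdec' : (fun i => (o i : ℂ)) = (l • V a + (o 3 : ℂ) • E) + r • V b := by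
    have h2 (i : Fin 3) : (o i.castSucc : ℂ) = l * formEval (X.1 i) a + r * formEval (X.1 i) b :=
      (congrFun h1 i).symm
    ext j
    refine Fin.lastCases ?_ (fun i => ?_) j
    · simp [V, E, Fin.last]
    · rw [h2]
      fin_cases i <;> simp [V, E]
  rw [hdec']
  exact Submodule.add_mem_sup (Submodule.add_mem _ (Submodule.smul_mem _ _ hA.2)
    (Submodule.smul_mem _ _ hA.1)) (Submodule.smul_mem _ _ hB.2)

/-- At a zero of `m` the derivative of `m Q` is that of `m` times `Q`, so the determinant splits
into a triple product and a Jacobian of `m` and `s`. Euler's relation evaluates the latter. -/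
theorem crossingNumerator_lift {X : Diagram n} {a b : Fin 2 → ℂ}
    (ha : formEval X.2.2 a = 0) (hb : formEval X.2.2 b = 0) :
    crossingNumerator e t o (X, 0, 0) a b * cross a b =
      ((n + 2 : ℕ) : ℂ) ^ 2 * formDeriv X.2.2 a b ^ 2 * formEval X.2.1 b *
        tripleProduct (fun i => (o i.castSucc : ℂ)) (ratEval X.1 a) (ratEval X.1 b) := by
  have hi (i : Fin 3) (z v : Fin 2 → ℂ) (hz : formEval X.2.2 z = 0) :
      formDeriv (lift X i.castSucc) z v = formDeriv X.2.2 z v * formEval (X.1 i) z := by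
    rw [lift_castSucc, formDeriv_formMul, hz]; ring
  rw [crossingNumerator, deform_zero, det_four_of_jacobian _ _ _ _ (ratEval X.1 a) (ratEval X.1 b)
    (formDeriv X.2.2 a b) (formDeriv X.2.2 b (Pi.single 0 1)) (formDeriv X.2.2 b (Pi.single 1 1))
    (fun i => hi i a b ha) (fun i => by rw [partialD_apply, hi i b _ hb]; rfl)
    (fun i => by rw [partialD_apply, hi i b _ hb]; rfl), partialD_apply, partialD_apply, lift_last]
  have e1 := formDeriv_self X.2.2 b
  have e2 := formDeriv_self X.2.1 b
  have e3 : formDeriv X.2.2 b a = formDeriv X.2.2 a b := by simp only [formDeriv_two]; ring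
  have e4 := formDeriv_eq X.2.2 b a
  rw [e3] at e4
  rw [hb, mul_zero, formDeriv_eq] at e1
  rw [formDeriv_eq] at e2
  have hJ : (formDeriv X.2.2 b (Pi.single 0 1) * formDeriv X.2.1 b (Pi.single 1 1) -
      formDeriv X.2.2 b (Pi.single 1 1) * formDeriv X.2.1 b (Pi.single 0 1)) * cross a b =
      ((n + 2 : ℕ) : ℂ) * formEval X.2.1 b * formDeriv X.2.2 a b := by
    rw [← e2, e4, cross]
    linear_combination (-(a 0 * formDeriv X.2.1 b (Pi.single 0 1) +
      a 1 * formDeriv X.2.1 b (Pi.single 1 1))) * e1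
  linear_combination (((n + 2 : ℕ) : ℂ) * formDeriv X.2.2 a b *
    tripleProduct (fun i => (o i.castSucc : ℂ)) (ratEval X.1 a) (ratEval X.1 b)) * hJ

/-- Near a real nodal curve with a positive side factor, the sign of a crossing is the sign of the
last parameter of the chart. -/
theorem eventually_crossingDet_re {X : Diagram n} {a b : Fin 2 → ℂ}
    (hd : DisjointDivisors X.2.1 X.2.2) (hm : X.2.2 ≠ 0)
    (hab : cross a b ≠ 0) (ha : formEval X.2.2 a = 0) (hb : formEval X.2.2 b = 0)
    (hr : IsRealPair a b) (hE : 0 < (sideFactor e t X a b).re)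
    (ho : (fun i => (o i : ℂ)) ∉ tangentLine (lift X) a ⊔ tangentLine (lift X) b) :
    ∀ᶠ x : (Diagram n × (Fin 3 → ℝ) × ℝ) × (Fin 2 → ℂ) × (Fin 2 → ℂ) in 𝓝 ((X, 0, 0), (a, b)),
      (fun i => (o i : ℂ)) ∈ Submodule.span ℂ
        {ratEval (deform e t x.1) x.2.1, ratEval (deform e t x.1) x.2.2} →
      ∃ h > 0, (crossingDet (deform e t x.1) x.2.1 x.2.2).re = x.1.2.2 * h := by
  have hq : ¬ SameImage X.1 a b := by
    rw [← degenerate_iff_sameImage hab]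
    intro hdeg
    simp [sideFactor, tripleBracket, hdeg _ _] at hE
  have hN := tripleProduct_ne_zero_of_notMem o hd hm hab ha hb hq ho
  have hs : formEval X.2.1 b ≠ 0 := fun hs => hd b (ne_zero_of_cross_ne_zero hab).2 ⟨hs, hb⟩
  have hP : formDeriv X.2.2 a b ≠ 0 := fun hP => hm (eq_zero_of_polar_eq_zero hab ha hb hP)
  have hC : crossingDenominator e t o (X, 0, 0) a b = formEval X.2.1 b *
      tripleProduct (fun i => (o i.castSucc : ℂ)) (ratEval X.1 a) (ratEval X.1 b) := by
    simp [crossingDenominator]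
  have hC0 : cross a b * crossingDenominator e t o (X, 0, 0) a b ≠ 0 := by
    rw [hC]; exact mul_ne_zero hab (mul_ne_zero hs hN)
  let H : (Diagram n × (Fin 3 → ℝ) × ℝ) × (Fin 2 → ℂ) × (Fin 2 → ℂ) → ℂ := fun x =>
    crossingNumerator e t o x.1 x.2.1 x.2.2 *
        (cross x.2.1 x.2.2 ^ 2 * sideFactor e t x.1.1 x.2.1 x.2.2) /
      (cross x.2.1 x.2.2 * crossingDenominator e t o x.1 x.2.1 x.2.2)
  have c1 := continuous_crossingNumerator e t o
  have c2 := continuous_crossingDenominator e t o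
  have c3 := continuous_sideFactor e t
  have c4 := continuous_cross
  have c5 : Continuous fun x : (Diagram n × (Fin 3 → ℝ) × ℝ) × (Fin 2 → ℂ) × (Fin 2 → ℂ) =>
      cross x.2.1 x.2.2 * crossingDenominator e t o x.1 x.2.1 x.2.2 := by fun_prop
  have c6 : Continuous fun x : (Diagram n × (Fin 3 → ℝ) × ℝ) × (Fin 2 → ℂ) × (Fin 2 → ℂ) =>
      crossingNumerator e t o x.1 x.2.1 x.2.2 *
        (cross x.2.1 x.2.2 ^ 2 * sideFactor e t x.1.1 x.2.1 x.2.2) := by fun_prop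
  have hH : ContinuousAt H ((X, 0, 0), (a, b)) := c6.continuousAt.div c5.continuousAt hC0
  -- The triple product involving `o` cancels between numerator and denominator: the sign does not
  -- depend on the point of view. The polar value of `m` is real and enters squared.
  have hH0 : H ((X, 0, 0), (a, b)) =
      ((n + 2 : ℕ) : ℂ) ^ 2 * formDeriv X.2.2 a b ^ 2 * sideFactor e t X a b := by
    have := crossingNumerator_lift e t o ha hb
    simp only [H]
    rw [div_eq_iff hC0, hC]
    linear_combination cross a b * sideFactor e t X a b * this
  have hpos : 0 < (H ((X, 0, 0), (a, b))).re := by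
    obtain ⟨r, hr⟩ : ∃ r : ℝ, formDeriv X.2.2 a b = r :=
      ⟨(formDeriv X.2.2 a b).re, Complex.ext (by simp) (by simpa using hr.formDeriv_two_im X.2.2)⟩
    rw [hr] at hP hH0
    have hr0 : r ≠ 0 := by exact_mod_cast hP
    have h1 : (((n + 2 : ℕ) : ℂ) ^ 2 * (r : ℂ) ^ 2) = (((n + 2 : ℕ) : ℝ) ^ 2 * r ^ 2 : ℝ) := by
      push_cast; ring
    rw [hH0, h1, Complex.re_ofReal_mul]
    have : (0 : ℝ) < ((n + 2 : ℕ) : ℝ) := by positivity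
    positivity
  have hre : ContinuousAt (fun x => (H x).re) ((X, 0, 0), (a, b)) :=
    Complex.continuous_re.continuousAt.comp hH
  filter_upwards [hre.eventually (lt_mem_nhds hpos), c5.continuousAt.eventually_ne hC0]
    with x hx1 hx2 hx3
  refine ⟨(H x).re, hx1, ?_⟩
  rw [← Complex.re_ofReal_mul]
  congr 1
  have := crossingDet_mul_denominator e t o hx3
  simp only [H]
  rw [mul_div_assoc', eq_div_iff hx2]
  exact this

end

/-! ### The chart is a submersion -/

theorem formMul_add_left {k l : ℕ} (f f' : BinaryForm k) (g : BinaryForm l) :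
    formMul (f + f') g = formMul f g + formMul f' g := by
  ext r
  simp only [formMul, Pi.add_apply, ← Finset.sum_add_distrib]
  refine Finset.sum_congr rfl fun i _ => Finset.sum_congr rfl fun j _ => ?_
  split_ifs <;> ring

theorem formMul_add_right {k l : ℕ} (f : BinaryForm k) (g g' : BinaryForm l) :
    formMul f (g + g') = formMul f g + formMul f g' := by
  ext r
  simp only [formMul, Pi.add_apply, ← Finset.sum_add_distrib]
  refine Finset.sum_congr rfl fun i _ => Finset.sum_congr rfl fun j _ => ?_
  split_ifs <;> ring

theorem formMul_smul_left {k l : ℕ} (c : ℝ) (f : BinaryForm k) (g : BinaryForm l) :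
    formMul (c • f) g = c • formMul f g := by
  ext r
  simp only [formMul, Pi.smul_apply, smul_eq_mul, Finset.mul_sum]
  refine Finset.sum_congr rfl fun i _ => Finset.sum_congr rfl fun j _ => ?_
  split_ifs <;> ring

theorem formMul_smul_right {k l : ℕ} (c : ℝ) (f : BinaryForm k) (g : BinaryForm l) :
    formMul f (c • g) = c • formMul f g := by
  ext r
  simp only [formMul, Pi.smul_apply, smul_eq_mul, Finset.mul_sum]
  refine Finset.sum_congr rfl fun i _ => Finset.sum_congr rfl fun j _ => ?_
  split_ifs <;> ring

theorem eq_zero_of_formMul_eq_zero {k l : ℕ} {f : BinaryForm k} {g : BinaryForm l}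
    (h : formMul f g = 0) (hg : g ≠ 0) : f = 0 := by
  let P {N : ℕ} (f : BinaryForm N) : Polynomial ℂ :=
    ∑ i : Fin (N + 1), Polynomial.C (f i : ℂ) * Polynomial.X ^ (i : ℕ)
  have hev {N : ℕ} (f : BinaryForm N) (x : ℂ) : (P f).eval x = formEval f ![x, 1] := by
    simp [P, formEval, Polynomial.eval_finsetSum]
  have hz {N : ℕ} (f : BinaryForm N) (h0 : P f = 0) : f = 0 := by
    ext i
    have h1 := congrArg (fun p => Polynomial.coeff p i) h0
    simp only [P, Polynomial.finsetSum_coeff, Polynomial.coeff_C_mul_X_pow,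
      Polynomial.coeff_zero] at h1
    rw [Finset.sum_eq_single i] at h1
    · simpa using h1
    · intro j _ hj
      rw [if_neg fun h => hj (Fin.ext h.symm)]
    · simp
  -- The affine polynomials of the forms multiply to zero because all values of the product vanish.
  have hPQ : P f * P g = 0 := Polynomial.funext fun x => by
    rw [Polynomial.eval_mul, hev, hev, ← formEval_formMul, h, formEval_zero, Polynomial.eval_zero]
  exact hz f ((mul_eq_zero.1 hPQ).resolve_right fun h0 => hg (hz g h0))

theorem contDiff_formMul {k l : ℕ} :
    ContDiff ℝ 1 fun p : BinaryForm k × BinaryForm l => formMul p.1 p.2 := by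
  unfold formMul
  refine contDiff_pi.2 fun r => ContDiff.sum fun i _ => ContDiff.sum fun j _ => ?_
  split_ifs <;> fun_prop

section

variable {n : ℕ} (e : Fin 3 → ℝ) (t : BinaryForm (n + 2))

theorem contDiff_deform : ContDiff ℝ 1 (deform e t) := by
  have h (i : Fin 3) : ContDiff ℝ 1 fun p : Diagram n × (Fin 3 → ℝ) × ℝ =>
      formMul (p.1.1 i) p.1.2.2 + p.2.1 i • p.1.2.1 + (p.2.2 * e i) • t := by
    refine ContDiff.add (ContDiff.add ?_ ?_) ?_
    · exact contDiff_formMul.comp (by fun_prop :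
        ContDiff ℝ 1 fun p : Diagram n × (Fin 3 → ℝ) × ℝ => (p.1.1 i, p.1.2.2))
    · fun_prop
    · fun_prop
  refine contDiff_pi.2 fun j => ?_
  refine Fin.lastCases ?_ (fun i => ?_) j
  · change ContDiff ℝ 1 fun p : Diagram n × (Fin 3 → ℝ) × ℝ => p.1.2.1
    fun_prop
  · simp only [deform_castSucc]
    exact h i

theorem fderiv_deform_castSucc (X : Diagram n) (v : Diagram n × (Fin 3 → ℝ) × ℝ) (i : Fin 3) :
    fderiv ℝ (deform e t) (X, 0, 0) v i.castSucc =
      formMul (X.1 i) v.1.2.2 + formMul (v.1.1 i) X.2.2 + v.2.1 i • X.2.1 + (v.2.2 * e i) • t := by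
  have h1 : HasDerivAt (fun τ : ℝ => deform e t ((X, 0, 0) + τ • v))
      (fderiv ℝ (deform e t) (X, 0, 0) v) 0 := by
    have h2 := (contDiff_deform e t).differentiable one_ne_zero (X, 0, 0)
    have h3 : HasDerivAt (fun τ : ℝ => (X, 0, 0) + τ • v) v 0 := by
      simpa using ((hasDerivAt_id (0 : ℝ)).smul_const v).const_add
        ((X, 0, 0) : Diagram n × (Fin 3 → ℝ) × ℝ)
    have h4 : HasFDerivAt (deform e t) (fderiv ℝ (deform e t) (X, 0, 0))
        (((X, 0, 0) : Diagram n × (Fin 3 → ℝ) × ℝ) + (0 : ℝ) • v) := by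
      simpa using h2.hasFDerivAt
    exact h4.comp_hasDerivAt (0 : ℝ) h3
  have h4 := hasDerivAt_pi.1 h1 i.castSucc
  let A : BinaryForm (n + 2) :=
    formMul (X.1 i) v.1.2.2 + formMul (v.1.1 i) X.2.2 + v.2.1 i • X.2.1 + (v.2.2 * e i) • t
  let B : BinaryForm (n + 2) := formMul (v.1.1 i) v.1.2.2 + v.2.1 i • v.1.2.1
  have h5 (τ : ℝ) : deform e t ((X, 0, 0) + τ • v) i.castSucc =
      formMul (X.1 i) X.2.2 + τ • A + τ ^ 2 • B := by
    rw [deform_castSucc]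
    simp only [Prod.fst_add, Prod.snd_add, Prod.smul_fst, Prod.smul_snd, Pi.add_apply,
      Pi.smul_apply, zero_add, Pi.zero_apply, formMul_add_left, formMul_add_right,
      formMul_smul_left, formMul_smul_right, A, B, smul_eq_mul]
    module
  have h6 : HasDerivAt (fun τ : ℝ => formMul (X.1 i) X.2.2 + τ • A + τ ^ 2 • B) A 0 := by
    have h7 := ((hasDerivAt_id (0 : ℝ)).smul_const A).const_add (formMul (X.1 i) X.2.2)
    have h8 := (hasDerivAt_pow 2 (0 : ℝ)).smul_const B
    simpa using h7.fun_add h8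
  simp only [h5] at h4
  exact h4.unique h6

theorem fderiv_deform_last (X : Diagram n) (v : Diagram n × (Fin 3 → ℝ) × ℝ) :
    fderiv ℝ (deform e t) (X, 0, 0) v 3 = v.1.2.1 := by
  have h2 := (contDiff_deform e t).differentiable one_ne_zero (X, 0, 0)
  have h3 : HasFDerivAt (fun p => deform e t p 3) _ (X, 0, 0) := hasFDerivAt_pi'.1 h2.hasFDerivAt 3
  have h4 : HasFDerivAt (fun p : Diagram n × (Fin 3 → ℝ) × ℝ => p.1.2.1) _ (X, 0, 0) :=
    (hasFDerivAt_fst (𝕜 := ℝ) (p := ((X, 0, 0) : Diagram n × (Fin 3 → ℝ) × ℝ))).snd.fst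
  exact DFunLike.congr_fun (h3.unique h4) v

/-- The only infinitesimal ambiguity is the rescaling of `Q` and `m` by inverse factors, which does
not change `m Q`. -/
theorem exists_eq_smul_of_fderiv_deform_eq_zero {X : Diagram n} {a b : Fin 2 → ℂ}
    (hd : DisjointDivisors X.2.1 X.2.2) (hm : X.2.2 ≠ 0)
    (hab : cross a b ≠ 0) (ha : formEval X.2.2 a = 0) (hb : formEval X.2.2 b = 0)
    (hE : sideFactor e t X a b ≠ 0) {v : Diagram n × (Fin 3 → ℝ) × ℝ}
    (hv : fderiv ℝ (deform e t) (X, 0, 0) v = 0) :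
    ∃ r : ℝ, r • (((-X.1, 0, X.2.2), 0, 0) : Diagram n × (Fin 3 → ℝ) × ℝ) = v := by
  have hs (z : Fin 2 → ℂ) (hz : z ≠ 0) (h : formEval X.2.2 z = 0) : formEval X.2.1 z ≠ 0 :=
    fun hs => hd z hz ⟨hs, h⟩
  have hsa := hs a (ne_zero_of_cross_ne_zero hab).1 ha
  have hsb := hs b (ne_zero_of_cross_ne_zero hab).2 hb
  have h0 (i : Fin 3) : formMul (X.1 i) v.1.2.2 + formMul (v.1.1 i) X.2.2 + v.2.1 i • X.2.1 +
      (v.2.2 * e i) • t = 0 := by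
    rw [← fderiv_deform_castSucc, hv]; rfl
  have h1 (i : Fin 3) (z : Fin 2 → ℂ) : formEval (X.1 i) z * formEval v.1.2.2 z +
      formEval (v.1.1 i) z * formEval X.2.2 z + v.2.1 i * formEval X.2.1 z +
        v.2.2 * e i * formEval t z = 0 := by
    have := congrArg (fun f => formEval f z) (h0 i)
    simpa only [formEval_add, formEval_smul, formEval_formMul, formEval_zero,
      Complex.ofReal_mul] using this
  -- At the zeros of `m` the variation of `Q` drops out; combining the two equations also eliminates
  -- the variation of `c`.
  have h2 (i : Fin 3) : formEval X.2.1 b * formEval v.1.2.2 a * formEval (X.1 i) a -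
      formEval X.2.1 a * formEval v.1.2.2 b * formEval (X.1 i) b +
        v.2.2 * e i * (cross a b * bracket t X.2.1 a b) = 0 := by
    have e1 := h1 i a
    have e2 := h1 i b
    rw [ha] at e1
    rw [hb] at e2
    rw [cross_mul_bracket]
    linear_combination formEval X.2.1 b * e1 - formEval X.2.1 a * e2
  -- Infinitesimal form of `Degenerate.mul_sideFactor_eq_zero`: contracting `h2` with `Q(a) × Q(b)`
  -- leaves the last parameter times the side factor.
  have hb0 : v.2.2 = 0 := by
    have h3 := cross_mul_tripleBracket_eq e X.1 a b
    have h4 : (v.2.2 : ℂ) * (cross a b ^ 2 * sideFactor e t X a b) = 0 := by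
      have h5 : (v.2.2 : ℂ) * (cross a b * bracket t X.2.1 a b) *
          (cross a b * tripleBracket e X.1 a b) = 0 := by
        rw [h3]
        simp only [tripleProduct, ratEval]
        linear_combination
          (formEval (X.1 1) a * formEval (X.1 2) b - formEval (X.1 1) b * formEval (X.1 2) a) * h2 0 +
          (formEval (X.1 2) a * formEval (X.1 0) b - formEval (X.1 2) b * formEval (X.1 0) a) * h2 1 +
          (formEval (X.1 0) a * formEval (X.1 1) b - formEval (X.1 0) b * formEval (X.1 1) a) * h2 2
      rw [sideFactor]
      linear_combination h5
    exact_mod_cast (mul_eq_zero.1 h4).resolve_right (mul_ne_zero (pow_ne_zero 2 hab) hE)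
  have hli : LinearIndependent ℂ ![ratEval X.1 a, ratEval X.1 b] := by
    by_contra hli
    refine hE ?_
    have hdeg := (degenerate_iff_sameImage hab).2 hli
    simp [sideFactor, tripleBracket, hdeg _ _]
  have h3 := LinearIndependent.pair_iff.1 hli (formEval X.2.1 b * formEval v.1.2.2 a)
    (-(formEval X.2.1 a * formEval v.1.2.2 b)) (by
      ext i
      have := h2 i
      rw [hb0] at this
      simp only [Pi.add_apply, Pi.smul_apply, smul_eq_mul, Pi.zero_apply, ratEval]
      simp only [Complex.ofReal_zero, zero_mul, add_zero] at this
      linear_combination this)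
  -- Independence of `Q(a)` and `Q(b)` makes the variation of `m` vanish at both zeros of `m`, so it
  -- is a multiple of `m`. The remaining components then follow one by one.
  have hva := (mul_eq_zero.1 h3.1).resolve_left hsb
  have hvb := (mul_eq_zero.1 (neg_eq_zero.1 h3.2)).resolve_left hsa
  obtain ⟨r, hr⟩ := eq_smul_of_common_zeros hab hm ha hb hva hvb
  have hc : v.2.1 = 0 := by
    ext i
    have := h1 i a
    rw [ha, hva, hb0] at this
    simpa [hsa] using this
  have hs' : v.1.2.1 = 0 := by
    rw [← fderiv_deform_last e t X, hv]; rfl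
  have hQ : v.1.1 = r • -X.1 := by
    funext i
    have h4 : formMul (v.1.1 i + r • X.1 i) X.2.2 = 0 := by
      have := h0 i
      rw [hr, hc, hb0, formMul_smul_right] at this
      rw [formMul_add_left, formMul_smul_left]
      simpa [add_comm] using this
    have h5 := eq_zero_of_formMul_eq_zero h4 hm
    simp only [Pi.smul_apply, Pi.neg_apply, smul_neg]
    exact eq_neg_of_add_eq_zero_left h5
  refine ⟨r, ?_⟩
  ext1
  · ext1
    · exact hQ.symm
    · ext1
      · simp [hs']
      · exact hr.symm
  · ext1
    · simp [hc]
    · simp [hb0]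

/-- Near the lift of a nodal diagram, all curves come from the chart. -/
theorem map_deform_nhds {X : Diagram n} {a b : Fin 2 → ℂ}
    (hd : DisjointDivisors X.2.1 X.2.2) (hm : X.2.2 ≠ 0)
    (hab : cross a b ≠ 0) (ha : formEval X.2.2 a = 0) (hb : formEval X.2.2 b = 0)
    (hE : sideFactor e t X a b ≠ 0) :
    map (deform e t) (𝓝 (X, 0, 0)) = 𝓝 (lift X) := by
  have hL : HasStrictFDerivAt (deform e t) (fderiv ℝ (deform e t) (X, 0, 0)) (X, 0, 0) :=
    (contDiff_deform e t).contDiffAt.hasStrictFDerivAt one_ne_zero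
  rw [← deform_zero e t X]
  refine hL.map_nhds_eq_of_surj ?_
  set L := fderiv ℝ (deform e t) (X, 0, 0)
  have hker : Module.finrank ℝ (LinearMap.ker L.toLinearMap) ≤ 1 := by
    refine (Submodule.finrank_mono (t := Submodule.span ℝ
      {(((-X.1, 0, X.2.2), 0, 0) : Diagram n × (Fin 3 → ℝ) × ℝ)}) fun v hv => ?_).trans ?_
    · obtain ⟨r, hr⟩ := exists_eq_smul_of_fderiv_deform_eq_zero e t hd hm hab ha hb hE hv
      exact Submodule.mem_span_singleton.2 ⟨r, hr⟩
    · exact (finrank_span_le_card _).trans (by simp)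
  have hrank := LinearMap.finrank_range_add_finrank_ker L.toLinearMap
  refine Submodule.eq_top_of_finrank_eq (le_antisymm (Submodule.finrank_le _) ?_)
  -- The source dimension exceeds that of the target by one, which is exactly accounted for by the
  -- kernel.
  have h1 : Module.finrank ℝ (Diagram n × (Fin 3 → ℝ) × ℝ) = 4 * n + 13 := by
    simp [Module.finrank_pi_fintype]; ring
  have h2 : Module.finrank ℝ (RatMap 3 (n + 2)) = 4 * n + 12 := by
    simp [Module.finrank_pi_fintype]; ring
  rw [h1] at hrank
  rw [h2]
  change _ ≤ Module.finrank ℝ (LinearMap.range L.toLinearMap)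
  omega

end

/-! ### Connecting coherent resolutions -/

theorem rigidlyIsotopic_of_joinedIn {d : ℕ} {γ₁ γ₂ : RatMap 3 d}
    (h : JoinedIn {γ | Embedded γ} γ₁ γ₂) : RigidlyIsotopic d (curveOf γ₁) (curveOf γ₂) := by
  obtain ⟨P, hP⟩ := h
  refine ⟨P.extend, P.continuous_extend.continuousOn, fun t ht => ?_, ?_, ?_⟩
  · rw [P.extend_apply ht]
    exact hP _
  · rw [P.extend_zero]
  · rw [P.extend_one]

theorem IsRealPair.norm_smul {z w : Fin 2 → ℂ} (h : IsRealPair z w) :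
    IsRealPair (((‖z‖⁻¹ : ℝ) : ℂ) • z) (((‖w‖⁻¹ : ℝ) : ℂ) • w) := by
  rcases h with h | h
  · refine Or.inl fun i => ?_
    simp [(h i).1, (h i).2]
  -- Conjugate vectors have equal norms, so normalizing them separately keeps them conjugate.
  · have hn : ‖w‖ = ‖z‖ := by
      simp only [Pi.norm_def, h, RCLike.nnnorm_conj]
    refine Or.inr fun i => ?_
    rw [hn]
    simp [h i]

/-- The side factor of a deformation is nonzero at all of its double points, and positive with
respect to real representatives. -/
def IsAdapted {n : ℕ} (e : Fin 3 → ℝ) (t : BinaryForm (n + 2))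
    (p : Diagram n × (Fin 3 → ℝ) × ℝ) (z w : Fin 2 → ℂ) : Prop :=
  Degenerate (deform e t p) z w →
    sideFactor e t p.1 z w ≠ 0 ∧ (IsRealPair z w → 0 < (sideFactor e t p.1 z w).re)

theorem IsAdapted.of_norm_smul {n : ℕ} {e : Fin 3 → ℝ} {t : BinaryForm (n + 2)}
    {p : Diagram n × (Fin 3 → ℝ) × ℝ} {z w : Fin 2 → ℂ} (hz : z ≠ 0) (hw : w ≠ 0)
    (h : IsAdapted e t p (((‖z‖⁻¹ : ℝ) : ℂ) • z) (((‖w‖⁻¹ : ℝ) : ℂ) • w)) :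
    IsAdapted e t p z w := by
  have hz' : ((‖z‖⁻¹ : ℝ) : ℂ) ≠ 0 := by simpa using hz
  have hw' : ((‖w‖⁻¹ : ℝ) : ℂ) ≠ 0 := by simpa using hw
  intro hd
  obtain ⟨h1, h2⟩ := h ((degenerate_smul hz' hw').2 hd)
  refine ⟨fun h0 => h1 ?_, fun hr => ?_⟩
  · have := sideFactor_smul e t p.1 ((‖z‖⁻¹ : ℝ) : ℂ) ((‖w‖⁻¹ : ℝ) : ℂ) z w
    rw [h0, mul_zero] at this
    exact (mul_eq_zero.1 this).resolve_left (pow_ne_zero _ (mul_ne_zero hz' hw'))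
  · have hz1 : z = (‖z‖ : ℂ) • (((‖z‖⁻¹ : ℝ) : ℂ) • z) := by
      rw [smul_smul, ← Complex.ofReal_mul, mul_inv_cancel₀ (norm_ne_zero_iff.2 hz),
        Complex.ofReal_one, one_smul]
    have hw1 : w = (‖w‖ : ℂ) • (((‖w‖⁻¹ : ℝ) : ℂ) • w) := by
      rw [smul_smul, ← Complex.ofReal_mul, mul_inv_cancel₀ (norm_ne_zero_iff.2 hw),
        Complex.ofReal_one, one_smul]
    rw [hz1, hw1]
    refine sideFactor_re_pos_smul e t ?_ ?_ (h2 hr.norm_smul)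
    · simp [hz, hw]
    · simp

/-- All relevant conditions are invariant under real rescaling, so pairs of unit vectors suffice,
and these form a compact set. Locally, non-degeneracy, non-vanishing and positivity are open; near a
pair that is not real the positivity clause is vacuous because `IsRealPair` is closed. -/
theorem eventually_isAdapted {n : ℕ} {X : Diagram n} {e : Fin 3 → ℝ}
    {t : BinaryForm (n + 2)} (h : ∀ z w : Fin 2 → ℂ, z ≠ 0 → w ≠ 0 → Degenerate (lift X) z w →
      sideFactor e t X z w ≠ 0 ∧ (IsRealPair z w → 0 < (sideFactor e t X z w).re)) :
    ∀ᶠ p in 𝓝 ((X, 0, 0) : Diagram n × (Fin 3 → ℝ) × ℝ),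
      ∀ z w : Fin 2 → ℂ, z ≠ 0 → w ≠ 0 → IsAdapted e t p z w := by
  have hK : IsCompact (Metric.sphere (0 : Fin 2 → ℂ) 1 ×ˢ Metric.sphere (0 : Fin 2 → ℂ) 1) :=
    (isCompact_sphere _ _).prod (isCompact_sphere _ _)
  have hne {z : Fin 2 → ℂ} (hz : z ∈ Metric.sphere (0 : Fin 2 → ℂ) 1) : z ≠ 0 := by
    rintro rfl; simp at hz
  have key := hK.eventually_forall_of_forall_eventually
    (x₀ := ((X, 0, 0) : Diagram n × (Fin 3 → ℝ) × ℝ)) (P := fun p y => IsAdapted e t p y.1 y.2) ?_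
  · filter_upwards [key] with p hp z w hz hw
    refine IsAdapted.of_norm_smul hz hw (hp (_, _) ⟨?_, ?_⟩)
    · simp [norm_smul, hz]
    · simp [norm_smul, hw]
  · rintro ⟨z, w⟩ ⟨hz, hw⟩
    have hsf : Continuous fun x : (Diagram n × (Fin 3 → ℝ) × ℝ) × (Fin 2 → ℂ) × (Fin 2 → ℂ) =>
        sideFactor e t x.1.1 x.2.1 x.2.2 := by
      have := continuous_sideFactor e t
      fun_prop
    by_cases hd : Degenerate (lift X) z w
    · obtain ⟨h1, h2⟩ := h z w (hne hz) (hne hw) hd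
      have e1 : ∀ᶠ x : (Diagram n × (Fin 3 → ℝ) × ℝ) × (Fin 2 → ℂ) × (Fin 2 → ℂ) in
          𝓝 ((X, 0, 0), (z, w)), sideFactor e t x.1.1 x.2.1 x.2.2 ≠ 0 :=
        (isOpen_ne.preimage hsf).mem_nhds h1
      by_cases hr : IsRealPair z w
      · have e2 : ∀ᶠ x : (Diagram n × (Fin 3 → ℝ) × ℝ) × (Fin 2 → ℂ) × (Fin 2 → ℂ) in
            𝓝 ((X, 0, 0), (z, w)), 0 < (sideFactor e t x.1.1 x.2.1 x.2.2).re :=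
          (isOpen_lt continuous_const (Complex.continuous_re.comp hsf)).mem_nhds (h2 hr)
        filter_upwards [e1, e2] with x hx1 hx2 _
        exact ⟨hx1, fun _ => hx2⟩
      · have e2 : ∀ᶠ x : (Diagram n × (Fin 3 → ℝ) × ℝ) × (Fin 2 → ℂ) × (Fin 2 → ℂ) in
            𝓝 ((X, 0, 0), (z, w)), ¬ IsRealPair x.2.1 x.2.2 :=
          (isClosed_isRealPair.isOpen_compl.preimage continuous_snd).mem_nhds hr
        filter_upwards [e1, e2] with x hx1 hx2 _
        exact ⟨hx1, fun hx3 => (hx2 hx3).elim⟩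
    · obtain ⟨i, hi⟩ := not_forall.1 hd
      obtain ⟨j, hij⟩ := not_forall.1 hi
      have hb : Continuous fun x : (Diagram n × (Fin 3 → ℝ) × ℝ) × (Fin 2 → ℂ) × (Fin 2 → ℂ) =>
          bracket (deform e t x.1 i) (deform e t x.1 j) x.2.1 x.2.2 := by
        have h1 := continuous_bracket (N := n + 2)
        have h2 := continuous_deform e t
        fun_prop
      rw [← deform_zero e t] at hij
      have e1 : ∀ᶠ x : (Diagram n × (Fin 3 → ℝ) × ℝ) × (Fin 2 → ℂ) × (Fin 2 → ℂ) in
          𝓝 ((X, 0, 0), (z, w)), bracket (deform e t x.1 i) (deform e t x.1 j) x.2.1 x.2.2 ≠ 0 :=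
        (isOpen_ne.preimage hb).mem_nhds hij
      filter_upwards [e1] with x hx1 hx2
      exact (hx1 (hx2 i j)).elim

theorem embedded_deform {n : ℕ} {e : Fin 3 → ℝ} {t : BinaryForm (n + 2)}
    {p : Diagram n × (Fin 3 → ℝ) × ℝ}
    (h : ∀ z w : Fin 2 → ℂ, z ≠ 0 → w ≠ 0 → IsAdapted e t p z w) (hp : p.2.2 ≠ 0) :
    Embedded (deform e t p) := by
  refine embedded_of_forall_not_degenerate (by omega) fun z w hz hw hd => ?_
  rcases mul_eq_zero.1 (hd.mul_sideFactor_eq_zero e t) with h0 | h0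
  · exact hp (by exact_mod_cast h0)
  · exact (h z w hz hw hd).1 h0

/-- The given resolution, followed backwards to a sufficiently early positive time, is a curve of
the chart on the side prescribed by `c`. -/
theorem IsResolution.exists_joinedIn {n : ℕ} {e : Fin 3 → ℝ} {t : BinaryForm (n + 2)}
    {X : Diagram n} {B : Set (Diagram n × (Fin 3 → ℝ) × ℝ)} (hB : B ∈ 𝓝 (X, 0, 0))
    (h : ∀ z w : Fin 2 → ℂ, z ≠ 0 → w ≠ 0 → IsAdapted e t (X, 0, 0) z w)
    (hd : DisjointDivisors X.2.1 X.2.2) (hm : X.2.2 ≠ 0) (hX : SmoothOffVertex X) {c : ℤˣ}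
    {K : Set (ℙ ℂ (Fin 4 → ℂ))} (hK : IsResolution (lift X) c K) :
    ∃ p ∈ B, 0 < ((c : ℤ) : ℝ) * p.2.2 ∧
      ∃ γ, curveOf γ = K ∧ JoinedIn {γ | Embedded γ} (deform e t p) γ := by
  obtain ⟨Γ, hΓ, hΓ0, hemb, rfl, a, b, hab, hsame, o, ho, α, β, hα, hβ, hev⟩ := hK
  obtain ⟨ha0, hb0⟩ := ne_zero_of_cross_ne_zero hab
  have hdeg := (degenerate_iff_sameImage hab).2 hsame
  have ha := hX.eq_zero_of_degenerate ha0 hb0 hdeg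
  have hb := hX.eq_zero_of_degenerate hb0 ha0 hdeg.symm
  have hαβ : Tendsto (fun t => (α t, β t)) (𝓝[>] 0) (𝓝 (a, b)) := hα.prodMk_nhds hβ
  -- The limit of real pairs is real, which makes the side factor at the node positive.
  have hreal : IsRealPair a b :=
    isClosed_isRealPair.mem_of_tendsto hαβ (hev.mono fun t ht => ht.1)
  obtain ⟨hE0, hE⟩ := h a b ha0 hb0 (by rwa [deform_zero])
  have hsign := eventually_crossingDet_re e t o hd hm hab ha hb hreal (hE hreal) ho
  rw [nhds_prod_eq, eventually_prod_iff] at hsign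
  obtain ⟨pa, hpa, pb, hpb, hsign⟩ := hsign
  have himg : deform e t '' (B ∩ {p | pa p}) ∈ 𝓝 (lift X) := by
    rw [← map_deform_nhds e t hd hm hab ha hb hE0]
    exact image_mem_map (inter_mem hB hpa)
  have hIoc : Set.Ioc (0 : ℝ) 1 ∈ 𝓝[>] (0 : ℝ) := Ioc_mem_nhdsGT one_pos
  have hΓt : Tendsto Γ (𝓝[>] 0) (𝓝 (lift X)) := by
    rw [← hΓ0]
    refine (hΓ 0 (by simp)).mono_left (nhdsWithin_le_of_mem ?_)
    exact mem_of_superset hIoc Set.Ioc_subset_Icc_self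
  -- One time `τ` suffices: no continuous choice of chart parameters along `Γ` is needed.
  obtain ⟨τ, hτ, ⟨p, ⟨hpB, hpa⟩, hp⟩, hpb, -, hspan, hpos⟩ :=
    ((show ∀ᶠ s in 𝓝[>] (0 : ℝ), s ∈ Set.Ioc (0 : ℝ) 1 from hIoc).and <| (hΓt.eventually himg).and <| (hαβ.eventually hpb).and hev).exists
  rw [← hp] at hspan hpos
  obtain ⟨r, hr, hre⟩ := hsign hpa hpb hspan
  rw [hre, ← mul_assoc] at hpos
  refine ⟨p, hpB, pos_of_mul_pos_left hpos hr.le, Γ 1, rfl, ?_⟩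
  rw [hp]
  have hmem {s : ℝ} (hs : s ∈ Set.Icc (0 : ℝ) 1) : τ + s * (1 - τ) ∈ Set.Ioc (0 : ℝ) 1 := by
    obtain ⟨h1, h2⟩ := hτ
    obtain ⟨h3, h4⟩ := hs
    constructor
    · nlinarith [mul_nonneg h3 (sub_nonneg.2 h2)]
    · nlinarith [mul_nonneg (sub_nonneg.2 h4) (sub_nonneg.2 h2)]
  -- The rest of the family, from `τ` to `1`, is reparametrized to the unit interval.
  refine JoinedIn.ofLine (f := fun s => Γ (τ + s * (1 - τ))) ?_ (by simp) (by simp) ?_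
  · exact hΓ.comp (by fun_prop) fun s hs => Set.Ioc_subset_Icc_self (hmem hs)
  · rintro _ ⟨s, hs, rfl⟩
    exact hemb _ (hmem hs)

/-- Any two nodal diagrams close to the central diagram have isotopic coherent resolutions. -/
theorem IsCentral.exists_mem_nhds {n : ℕ} {X₀ : Diagram n} (hX : IsCentral X₀) :
    ∃ U ∈ 𝓝 X₀, ∀ X₁ ∈ U, ∀ X₂ ∈ U, ExplicitNodalDiagramsEquivalent X₁ X₂ := by
  obtain ⟨e, t, h⟩ := hX.exists_chart
  have hm : ∀ᶠ p in 𝓝 ((X₀, 0, 0) : Diagram n × (Fin 3 → ℝ) × ℝ), p.1.2.2 ≠ 0 :=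
    ContinuousAt.eventually_ne (by fun_prop) hX.ne_zero
  obtain ⟨ε, hε, hball⟩ := Metric.eventually_nhds_iff_ball.1
    ((eventually_isAdapted h).and hm)
  let B := Metric.ball ((X₀, 0, 0) : Diagram n × (Fin 3 → ℝ) × ℝ) ε
  have hB : IsOpen B := Metric.isOpen_ball
  have hc : Continuous fun X : Diagram n => ((X, 0, 0) : Diagram n × (Fin 3 → ℝ) × ℝ) := by
    fun_prop
  refine ⟨(fun X : Diagram n => ((X, 0, 0) : Diagram n × (Fin 3 → ℝ) × ℝ)) ⁻¹' B,
    hc.continuousAt.preimage_mem_nhds (Metric.ball_mem_nhds _ hε), ?_⟩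
  intro X₁ h₁ X₂ h₂ hX₁ _ hX₂ _ c K₁ K₂ hK₁ hK₂
  have res {X : Diagram n} (hXB : (X, 0, 0) ∈ B) (hXn : IsNodalDiagram X)
      {K : Set (ℙ ℂ (Fin 4 → ℂ))} (hK : IsResolution (lift X) c K) :=
    hK.exists_joinedIn (e := e) (t := t) (hB.mem_nhds hXB) (hball _ hXB).1 hXn.2.1 (hball _ hXB).2
      hXn.2.2.2
  obtain ⟨p₁, hp₁, hc₁, γ₁, rfl, hγ₁⟩ := res h₁ hX₁ hK₁
  obtain ⟨p₂, hp₂, hc₂, γ₂, rfl, hγ₂⟩ := res h₂ hX₂ hK₂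
  -- One side of the discriminant in the chart is a ball cut by an open half-space, so a segment
  -- joins the two parameters without meeting the discriminant.
  have hconv : Convex ℝ (B ∩ {p | 0 < ((c : ℤ) : ℝ) * p.2.2}) := by
    refine (convex_ball _ _).inter ?_
    exact convex_halfSpace_gt (f := fun p : Diagram n × (Fin 3 → ℝ) × ℝ => ((c : ℤ) : ℝ) * p.2.2)
      ⟨fun p q => by simp [mul_add], fun r p => by simp; ring⟩ 0
  have hj : JoinedIn (B ∩ {p | 0 < ((c : ℤ) : ℝ) * p.2.2}) p₁ p₂ :=
    JoinedIn.of_segment_subset (hconv.segment_subset ⟨hp₁, hc₁⟩ ⟨hp₂, hc₂⟩)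
  have hj' : JoinedIn {γ | Embedded γ} (deform e t p₁) (deform e t p₂) := by
    refine (hj.map (continuous_deform e t)).mono ?_
    rintro _ ⟨p, ⟨hp, hcp⟩, rfl⟩
    refine embedded_deform (hball p hp).1 fun h0 => ?_
    have hcp : 0 < ((c : ℤ) : ℝ) * p.2.2 := hcp
    simp [h0] at hcp
  exact rigidlyIsotopic_of_joinedIn ((hγ₁.symm.trans hj').trans hγ₂)

/-! ### The moves -/

theorem formEval_pointForm (u : Fin 2 → ℝ) (z : Fin 2 → ℂ) :
    formEval (pointForm u) z = cross z (toComplex u) := by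
  simp [formEval, pointForm, cross, toComplex, Fin.sum_univ_two]; ring

theorem SameImage.symm {k n : ℕ} {γ : RatMap k n} {z w : Fin 2 → ℂ} (hc : cross z w ≠ 0)
    (h : SameImage γ z w) : cross w z ≠ 0 ∧ SameImage γ w z := by
  have hc' : cross w z ≠ 0 := by rw [cross_swap]; exact neg_ne_zero.2 hc
  exact ⟨hc', (degenerate_iff_sameImage hc').1 ((degenerate_iff_sameImage hc).2 h).symm⟩

theorem formEval_eq_zero_of_cross_eq_zero {N : ℕ} {f : BinaryForm N} {z w : Fin 2 → ℂ} (hz : z ≠ 0)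
    (hw : w ≠ 0) (h : cross z w = 0) (hf : formEval f z = 0) : formEval f w = 0 := by
  obtain ⟨c, -, rfl⟩ := exists_eq_smul_of_cross_eq_zero hz hw h
  rw [formEval_scale, hf, mul_zero]

theorem cross_trans {x y z : Fin 2 → ℂ} (hz : z ≠ 0) (hx : cross x z = 0) (hy : cross y z = 0) :
    cross x y = 0 := by
  unfold cross at *
  rcases exists_apply_ne_zero hz with h | h
  · refine (mul_eq_zero.1 ?_).resolve_left h
    linear_combination y 0 * hx - x 0 * hy
  · refine (mul_eq_zero.1 ?_).resolve_left h
    linear_combination y 1 * hx - x 1 * hy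

theorem IsNodalCurve.avoidsNodes {n l : ℕ} {q : RatMap 2 n} (hq : IsNodalCurve q)
    {f : BinaryForm l} (hf : AvoidsNodes q f) {x y : Fin 2 → ℂ} (hxy : cross x y ≠ 0)
    (h : SameImage q x y) : formEval f x ≠ 0 ∧ formEval f y ≠ 0 :=
  ⟨hf x y (hq.2.2 x y hxy h), hf y x (hq.2.2 y x (h.symm hxy).1 (h.symm hxy).2)⟩

/-- Only the pole at `v` lies over a node, and the other branch of that node, at `u`, carries a zero
of the section and no pole. Hence no two distinct poles have the same image. -/
theorem isCentral_addPoints {n : ℕ} {q : RatMap 2 n} {u v : Fin 2 → ℝ} {s : BinaryForm (n + 1)}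
    {m : BinaryForm 1} (hq : IsNodalCurve q) (huv : IsNode q (toComplex u) (toComplex v))
    (hs : AvoidsNodes q s) (hm : AvoidsNodes q m) (hd : DisjointDivisors s m)
    (hX : SmoothOffVertex (addPoints q s m u v)) : IsCentral (addPoints q s m u v) := by
  obtain ⟨hu0, hv0⟩ := ne_zero_of_cross_ne_zero huv.1
  obtain ⟨-, hsv⟩ := hq.avoidsNodes hs huv.1 huv.2.1
  obtain ⟨hmu, -⟩ := hq.avoidsNodes hm huv.1 huv.2.1
  have hS (z : Fin 2 → ℂ) : formEval (addPoints q s m u v).2.1 z =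
      formEval s z * cross z (toComplex u) := by
    rw [← formEval_pointForm]; exact formEval_formMul s (pointForm u) z
  have hM (z : Fin 2 → ℂ) : formEval (addPoints q s m u v).2.2 z =
      formEval m z * cross z (toComplex v) := by
    rw [← formEval_pointForm]; exact formEval_formMul m (pointForm v) z
  refine ⟨hq.1, ?_, ?_, hX, ?_, fun x hx _ => hq.2.1 x hx⟩
  · rintro z hz ⟨h1, h2⟩
    rw [hS] at h1
    rw [hM] at h2
    rcases mul_eq_zero.1 h1 with h1 | h1 <;> rcases mul_eq_zero.1 h2 with h2 | h2
    · exact hd z hz ⟨h1, h2⟩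
    · exact hsv (formEval_eq_zero_of_cross_eq_zero hz hv0 h2 h1)
    · exact hmu (formEval_eq_zero_of_cross_eq_zero hz hu0 h1 h2)
    · refine huv.1 (cross_trans hz ?_ ?_)
      · rw [cross_swap, h1, neg_zero]
      · rw [cross_swap, h2, neg_zero]
  · intro h0
    have h1 := hM (toComplex u)
    rw [h0, formEval_zero] at h1
    exact mul_ne_zero hmu huv.1 h1.symm
  · intro x y hxy hx hy h
    obtain ⟨h1, h2⟩ := hq.avoidsNodes hm hxy h
    rw [hM] at hx hy
    exact hxy (cross_trans hv0 ((mul_eq_zero.1 hx).resolve_left h1)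
      ((mul_eq_zero.1 hy).resolve_left h2))

theorem toComplex_ne_zero {x : Fin 2 → ℝ} (hx : x ≠ 0) : toComplex x ≠ 0 := by
  intro h
  apply hx
  ext i
  have := congrFun h i
  simpa [toComplex] using this

/-- There is a single pole, so the condition on distinct poles is vacuous; immersion of the nodal
curve at `x` is what makes the singularity at `p` tame. -/
theorem isCentral_doublePoint {n : ℕ} {q : RatMap 2 n} {s : BinaryForm (n + 2)} {x : Fin 2 → ℝ}
    (hq : IsNodalCurve q) (hx : x ≠ 0) (hs : formEval s x ≠ 0)
    (hX : SmoothOffVertex (q, s, doublePoint x)) : IsCentral (q, s, doublePoint x) := by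
  have hx0 := toComplex_ne_zero hx
  have hs' : formEval s (toComplex x) ≠ 0 := by
    rw [formEval_toComplex]; exact_mod_cast hs
  have hM (z : Fin 2 → ℂ) : formEval (doublePoint x) z = cross z (toComplex x) ^ 2 := by
    rw [sq, ← formEval_pointForm]; exact formEval_formMul (pointForm x) (pointForm x) z
  have hz {z : Fin 2 → ℂ} (h : formEval (doublePoint x) z = 0) : cross z (toComplex x) = 0 := by
    rw [hM] at h; exact pow_eq_zero_iff two_ne_zero |>.1 h
  refine ⟨hq.1, ?_, ?_, hX, ?_, fun x hx _ => hq.2.1 x hx⟩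
  · rintro z hz0 ⟨h1, h2⟩
    exact hs' (formEval_eq_zero_of_cross_eq_zero hz0 hx0 (hz h2) h1)
  · intro h0
    have h0 : doublePoint x = 0 := h0
    have h1 (z : Fin 2 → ℂ) : cross z (toComplex x) = 0 := hz (by rw [h0, formEval_zero])
    have h2 := h1 ![1, 0]
    have h3 := h1 ![0, 1]
    simp [cross] at h2 h3
    exact hx0 (by ext i; fin_cases i <;> simp [h2, h3])
  · intro y z hyz hy hz'
    exact (hyz (cross_trans hx0 (hz hy) (hz hz'))).elim

theorem ne_zero_of_formEval_ne_zero {N : ℕ} {f : BinaryForm N} {z : Fin 2 → ℂ}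
    (h : formEval f z ≠ 0) : f ≠ 0 := by
  rintro rfl; exact h (formEval_zero z)

/-- The section vanishes at the cusp, so by disjointness the cusp is not a pole, and the curve is
immersed at every pole. -/
theorem isCentral_of_isUnicuspidal {n : ℕ} {q : RatMap 2 n} {s : BinaryForm (n + 2)}
    {m : BinaryForm 2} {a : Fin 2 → ℝ} (hq : IsUnicuspidal q a) (hm : AvoidsNodes q m)
    (hd : DisjointDivisors s m) (hX : SmoothOffVertex (q, s, m)) (ha : formEval s a = 0) :
    IsCentral (q, s, m) := by
  have ha0 := toComplex_ne_zero hq.2.1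
  have hsa : formEval s (toComplex a) = 0 := by rw [formEval_toComplex, ha, Complex.ofReal_zero]
  have hma : formEval m (toComplex a) ≠ 0 := fun h => hd _ ha0 ⟨hsa, h⟩
  refine ⟨hq.1, hd, ne_zero_of_formEval_ne_zero hma, hX, ?_, ?_⟩
  · intro x y hxy hx hy h
    exact hm x y (hq.2.2.2.2 x y hxy h) hx
  · intro x hx hmx
    refine hq.2.2.2.1 x hx fun h => hma ?_
    exact formEval_eq_zero_of_cross_eq_zero hx ha0 (by rw [cross_swap, h, neg_zero]) hmx

/-- Two poles with the same image would lie over a simple node or over the tacnode; both are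
excluded. -/
theorem isCentral_of_isUnitacnodal {n : ℕ} {q : RatMap 2 n} {s : BinaryForm (n + 2)}
    {m : BinaryForm 2} {a b : Fin 2 → ℂ} (hq : IsUnitacnodal q a b) (hm : AvoidsNodes q m)
    (hd : DisjointDivisors s m) (hX : SmoothOffVertex (q, s, m)) (hma : formEval m a ≠ 0)
    (hmb : formEval m b ≠ 0) : IsCentral (q, s, m) := by
  obtain ⟨ha0, hb0⟩ := ne_zero_of_cross_ne_zero hq.2.1.1
  refine ⟨hq.1, hd, ne_zero_of_formEval_ne_zero hma, hX, ?_, fun x hx _ => hq.2.2.1 x hx⟩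
  intro x y hxy hx hy h
  have hx0 := (ne_zero_of_cross_ne_zero hxy).1
  rcases hq.2.2.2 x y hxy h with h | h | h
  · exact hm x y h hx
  · exact hma (formEval_eq_zero_of_cross_eq_zero hx0 ha0 h.1 hx)
  · exact hmb (formEval_eq_zero_of_cross_eq_zero hx0 hb0 h.1 hx)

/-- Disjointness keeps poles away from `a`, so two poles over the triple point would have to be `b`
and `c`, the excluded case. -/
theorem isCentral_of_isUnitriple {n : ℕ} {q : RatMap 2 n} {s : BinaryForm (n + 2)}
    {m : BinaryForm 2} {a b c : Fin 2 → ℂ} (hq : IsUnitriple q a b c) (hm : AvoidsNodes q m)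
    (hd : DisjointDivisors s m) (hX : SmoothOffVertex (q, s, m)) (hsa : formEval s a = 0)
    (hbc : ¬ (formEval m b = 0 ∧ formEval m c = 0)) : IsCentral (q, s, m) := by
  obtain ⟨ha0, hb0⟩ := ne_zero_of_cross_ne_zero hq.2.1.1.1
  have hc0 := (ne_zero_of_cross_ne_zero hq.2.1.1.2.1).2
  have hma : formEval m a ≠ 0 := fun h => hd _ ha0 ⟨hsa, h⟩
  refine ⟨hq.1, hd, ne_zero_of_formEval_ne_zero hma, hX, ?_, fun x hx _ => hq.2.2.1 x hx⟩
  intro x y hxy hx hy h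
  obtain ⟨hx0, hy0⟩ := ne_zero_of_cross_ne_zero hxy
  rcases hq.2.2.2 x y hxy h with h | ⟨h1, h2⟩
  · exact hm x y h hx
  · have h1 := h1.resolve_left fun h => hma (formEval_eq_zero_of_cross_eq_zero hx0 ha0 h hx)
    have h2 := h2.resolve_left fun h => hma (formEval_eq_zero_of_cross_eq_zero hy0 ha0 h hy)
    rcases h1 with h1 | h1 <;> rcases h2 with h2 | h2
    · exact hxy (cross_trans hb0 h1 h2)
    · exact hbc ⟨formEval_eq_zero_of_cross_eq_zero hx0 hb0 h1 hx,
        formEval_eq_zero_of_cross_eq_zero hy0 hc0 h2 hy⟩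
    · exact hbc ⟨formEval_eq_zero_of_cross_eq_zero hy0 hb0 h2 hy,
        formEval_eq_zero_of_cross_eq_zero hx0 hc0 h1 hx⟩
    · exact hxy (cross_trans hc0 h1 h2)

theorem continuous_pointForm : Continuous pointForm := by
  refine continuous_pi fun i => ?_
  fin_cases i
  · change Continuous fun u : Fin 2 → ℝ => -u 0
    fun_prop
  · change Continuous fun u : Fin 2 → ℝ => u 1
    fun_prop

theorem continuous_addPoints {n : ℕ} (q : RatMap 2 n) (s : BinaryForm (n + 1)) (m : BinaryForm 1) :
    Continuous fun p : (Fin 2 → ℝ) × (Fin 2 → ℝ) => addPoints q s m p.1 p.2 := by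
  have h := continuous_pointForm
  have h1 : Continuous fun p : (Fin 2 → ℝ) × (Fin 2 → ℝ) => formMul s (pointForm p.1) :=
    continuous_formMul.comp (continuous_const.prodMk (h.comp continuous_fst))
  have h2 : Continuous fun p : (Fin 2 → ℝ) × (Fin 2 → ℝ) => formMul m (pointForm p.2) :=
    continuous_formMul.comp (continuous_const.prodMk (h.comp continuous_snd))
  exact continuous_const.prodMk (h1.prodMk h2)

end

/-! ### The five moves together -/

theorem mainTheorem5 (n : ℕ) :
    -- moving a pole
    (∀ (q : RatMap 2 n) (u v : Fin 2 → ℝ) (s : BinaryForm (n + 1)) (m : BinaryForm 1),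
      IsNodalCurve q → IsNode q (toComplex u) (toComplex v) →
      AvoidsNodes q s → AvoidsNodes q m → DisjointDivisors s m →
      SmoothOffVertex (addPoints q s m u v) →
      ∃ U ∈ 𝓝 u, ∃ V ∈ 𝓝 v, ∀ u₁ ∈ U, ∀ u₂ ∈ U, ∀ v₁ ∈ V, ∀ v₂ ∈ V,
        cross u u₁ * cross u u₂ < 0 → cross v v₁ * cross v v₂ < 0 →
        ExplicitNodalDiagramsEquivalent (addPoints q s m u₁ v₁) (addPoints q s m u₂ v₂)) ∧
    -- annihilation of two poles
    (∀ (q : RatMap 2 n) (s : BinaryForm (n + 2)) (x : Fin 2 → ℝ),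
      IsNodalCurve q → AvoidsNodes q s → x ≠ 0 → formEval s x ≠ 0 →
      (∀ w : Fin 2 → ℂ, ¬ IsNode q (toComplex x) w) →
      SmoothOffVertex (q, s, doublePoint x) →
      ∃ U ∈ 𝓝 (doublePoint x), ∀ m₁ ∈ U, ∀ m₂ ∈ U,
        (∃ y z : Fin 2 → ℝ, cross y z ≠ 0 ∧ formEval m₁ y = 0 ∧ formEval m₁ z = 0) →
        (∀ y : Fin 2 → ℝ, y ≠ 0 → formEval m₂ y ≠ 0) →
        ExplicitNodalDiagramsEquivalent (q, s, m₁) (q, s, m₂)) ∧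
    -- Reidemeister 1: passing through a cusp
    (∀ (q : RatMap 2 n) (s : BinaryForm (n + 2)) (m : BinaryForm 2) (a : Fin 2 → ℝ),
      IsUnicuspidal q a → AvoidsNodes q s → AvoidsNodes q m → DisjointDivisors s m →
      SmoothOffVertex (q, s, m) →
      formEval s a = 0 →
      SmallDeformationsEquivalent (q, s, m)) ∧
    -- Reidemeister 2: passing through a tacnode
    (∀ (q : RatMap 2 n) (s : BinaryForm (n + 2)) (m : BinaryForm 2) (a b : Fin 2 → ℂ),
      IsUnitacnodal q a b → AvoidsNodes q s → AvoidsNodes q m → DisjointDivisors s m →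
      SmoothOffVertex (q, s, m) →
      formEval s a ≠ 0 → formEval s b ≠ 0 → formEval m a ≠ 0 → formEval m b ≠ 0 →
      SmallDeformationsEquivalent (q, s, m)) ∧
    -- Reidemeister 3: passing through a triple point
    (∀ (q : RatMap 2 n) (s : BinaryForm (n + 2)) (m : BinaryForm 2) (a b c : Fin 2 → ℂ),
      IsUnitriple q a b c → AvoidsNodes q s → AvoidsNodes q m → DisjointDivisors s m →
      SmoothOffVertex (q, s, m) →
      formEval s a = 0 → formEval s b ≠ 0 → formEval s c ≠ 0 →
      ¬ (formEval m b = 0 ∧ formEval m c = 0) →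
      SmallDeformationsEquivalent (q, s, m)) := by
  refine ⟨?_, ?_, ?_, ?_, ?_⟩
  · intro q u v s m hq huv hs hm hd hX
    obtain ⟨W, hW, h⟩ := (isCentral_addPoints hq huv hs hm hd hX).exists_mem_nhds
    have hW' := (continuous_addPoints q s m).continuousAt.preimage_mem_nhds (x := (u, v)) hW
    obtain ⟨U, hU, V, hV, hUV⟩ := mem_nhds_prod_iff.1 hW'
    exact ⟨U, hU, V, hV, fun u₁ h1 u₂ h2 v₁ h3 v₂ h4 _ _ =>
      h _ (hUV (Set.mk_mem_prod h1 h3)) _ (hUV (Set.mk_mem_prod h2 h4))⟩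
  · intro q s x hq _ hx hsx _ hX
    obtain ⟨W, hW, h⟩ := (isCentral_doublePoint hq hx hsx hX).exists_mem_nhds
    have hc : Continuous fun m : BinaryForm 2 => ((q, s, m) : Diagram n) := by fun_prop
    exact ⟨_, hc.continuousAt.preimage_mem_nhds hW, fun m₁ h1 m₂ h2 _ _ => h _ h1 _ h2⟩
  · intro q s m a hq _ hm hd hX ha
    exact (isCentral_of_isUnicuspidal hq hm hd hX ha).exists_mem_nhds
  · intro q s m a b hq _ hm hd hX _ _ hma hmb
    exact (isCentral_of_isUnitacnodal hq hm hd hX hma hmb).exists_mem_nhds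
  · intro q s m a b c hq _ hm hd hX hsa _ _ hbc
    exact (isCentral_of_isUnitriple hq hm hd hX hsa hbc).exists_mem_nhds
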